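/- On $\mathbb{R}^8$ let $\Omega_0=\tfrac12(\omega_1\wedge\omega_1+\omega_2\wedge\omega_2+\omega_3\wedge\omega_3)$ with $\omega_1=dx_{12}+dx_{34}+dx_{56}+dx_{78}$, $\omega_2=dx_{13}-dx_{24}+dx_{57}-dx_{68}$, $\omega_3=dx_{14}+dx_{23}+dx_{58}+dx_{67}$; its stabiliser in $\mathrm{GL}(8,\mathbb{R})$ is $\mathrm{Sp}(2)\mathrm{Sp}(1)\subset \mathrm{SO}(8)$. An $\mathrm{Sp}(2)\mathrm{Sp}(1)$-structure on a smooth $8$-manifold is a smooth $4$-form $\Omega$ which at each point is identified with $\Omega_0$ by some linear isomorphism of the tangent space with $\mathbb{R}^8$; the metric $g$ that it determines is the pull-back of the Euclidean one. For a $2$-form, let $\diamond$ be given by $(\alpha\wedge\beta)\diamond\Omega=\alpha\wedge(\beta^\sharp\lrcorner\,\Omega)-\beta\wedge(\alpha^\sharp\lrcorner\,\Omega)$, and let $\Lambda^2_{15}\subset\Lambda^2$ be the orthogonal complement of $\ker(\cdot\diamond\Omega)\cong\mathfrak{sp}(1)\oplus\mathfrak{sp}(2)$. The intrinsic torsion of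 $\Omega$ is the unique $1$-form $T$ with values in $\Lambda^2_{15}$ such that $\nabla_X\Omega=T(X)\diamond\Omega$ for all $X$, where $\nabla$ is the Levi-Civita connection of $g$. The structure is torsion-free if $T=0$, and harmonic if $\operatorname{div}T=\operatorname{tr}_g(\nabla T)=0$. Theorem. Let $M$ be a smooth $8$-manifold with an $\mathrm{Sp}(2)\mathrm{Sp}(1)$-structure $\tilde\Omega$ and associated metric $\tilde g$, and suppose that it is locally conformally parallel: every point has an open neighbourhood $U$ with a smooth function $f$ on $U$ such that $\Omega=e^{-4f}\tilde\Omega$, whose metric is $g=e^{-2f}\tilde g$, is a torsion-free $\mathrm{Sp}(2)\mathrm{Sp}(1)$-structure on $U$. Then $\tilde\Omega$ is harmonic: its intrinsic torsion $\tilde T$ satisfies $\operatorname{div}_{\tilde g}\tilde T=0$ on $M$. -/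

import Mathlib

open scoped Manifold ContDiff Matrix

noncomputable section

namespace QK

/-- Euclidean `ℝ⁸`, the model space of all manifolds below. Indices run over `0, …, 7`. -/
abbrev E8 : Type := EuclideanSpace ℝ (Fin 8)

/-- The `i`-th vector of the standard basis of `ℝ⁸`. -/
def stdVec (i : Fin 8) : E8 := EuclideanSpace.single i 1

/-! ### The model 4-form and adapted frames -/

/-- `dx_i ∧ dx_j`, evaluated on two vectors of `ℝ⁸`. -/
def dx (i j : Fin 8) (v w : E8) : ℝ := v i * w j - v j * w i

/-- `ω₁ = dx₁₂ + dx₃₄ + dx₅₆ + dx₇₈` (with indices shifted to start at `0`). -/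
def omega1 (v w : E8) : ℝ := dx 0 1 v w + dx 2 3 v w + dx 4 5 v w + dx 6 7 v w

/-- `ω₂ = dx₁₃ - dx₂₄ + dx₅₇ - dx₆₈` (with indices shifted to start at `0`). -/
def omega2 (v w : E8) : ℝ := dx 0 2 v w - dx 1 3 v w + dx 4 6 v w - dx 5 7 v w

/-- `ω₃ = dx₁₄ + dx₂₃ + dx₅₈ + dx₆₇` (with indices shifted to start at `0`). -/
def omega3 (v w : E8) : ℝ := dx 0 3 v w + dx 1 2 v w + dx 4 7 v w + dx 5 6 v w

/-- The 4-form `½ (η ∧ η)` of a 2-form `η`, evaluated on four vectors. -/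
def halfSquare (η : E8 → E8 → ℝ) (v : Fin 4 → E8) : ℝ :=
  η (v 0) (v 1) * η (v 2) (v 3) - η (v 0) (v 2) * η (v 1) (v 3) + η (v 0) (v 3) * η (v 1) (v 2)

/-- The model `Ω₀ = ½ (ω₁ ∧ ω₁ + ω₂ ∧ ω₂ + ω₃ ∧ ω₃)`. -/
def modelForm (v : Fin 4 → E8) : ℝ :=
  halfSquare omega1 v + halfSquare omega2 v + halfSquare omega3 v

/-- A bilinear form `g` and a 4-form `Ω` on a vector space are *adapted* to each other if a linear
isomorphism with `ℝ⁸` takes `Ω` to `Ω₀` and `g` to the Euclidean inner product. As the stabiliser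
of `Ω₀` in `GL(8, ℝ)` is `Sp(2)Sp(1) ⊆ SO(8)`, the form `Ω` then determines `g`. -/
def IsAdapted {V : Type*} [AddCommGroup V] [Module ℝ V] [TopologicalSpace V]
    (g : V →L[ℝ] V →L[ℝ] ℝ) (Ω : V [⋀^Fin 4]→L[ℝ] ℝ) : Prop :=
  ∃ L : V ≃ₗ[ℝ] E8, (∀ v w, g v w = inner ℝ (L v) (L w)) ∧
    ∀ v : Fin 4 → V, Ω v = modelForm fun a => L (v a)

/-- The metric determined by `e^{-4t} Ω` is `e^{-2t} g` if `g` is the one determined by `Ω`. -/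
theorem IsAdapted.rescale {V : Type*} [AddCommGroup V] [Module ℝ V] [TopologicalSpace V]
    [IsTopologicalAddGroup V] [ContinuousSMul ℝ V]
    {g : V →L[ℝ] V →L[ℝ] ℝ} {Ω : V [⋀^Fin 4]→L[ℝ] ℝ} (h : IsAdapted g Ω) (t : ℝ) :
    IsAdapted (Real.exp (-2 * t) • g) (Real.exp (-4 * t) • Ω) := by
  obtain ⟨L, hg, hΩ⟩ := h
  have e2 : Real.exp (-2 * t) = Real.exp (-t) * Real.exp (-t) := by
    rw [← Real.exp_add]; ring_nf
  have e4 : Real.exp (-4 * t) =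
      Real.exp (-t) * Real.exp (-t) * (Real.exp (-t) * Real.exp (-t)) := by
    rw [← Real.exp_add, ← Real.exp_add]; ring_nf
  refine ⟨L.trans (LinearEquiv.smulOfNeZero ℝ E8 (Real.exp (-t)) (Real.exp_ne_zero _)), ?_, ?_⟩
  · intro v w
    change Real.exp (-2 * t) * g v w =
      inner ℝ (Real.exp (-t) • L v) (Real.exp (-t) • L w)
    rw [hg, e2, real_inner_smul_left, real_inner_smul_right, mul_assoc]
  · intro v
    change Real.exp (-4 * t) * Ω v = modelForm fun a => Real.exp (-t) • L (v a)
    rw [hΩ, e4]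
    simp only [modelForm, halfSquare, omega1, omega2, omega3, dx, PiLp.smul_apply, smul_eq_mul]
    ring

/-! ### Tensor algebra at a point, in components

`G` is the Gram matrix of a metric, `W` and `α` are the components of a 4-form and of a 2-form. -/

/-- The infinitesimal action `α ⋄ Ω`, determined by
`(a ∧ b) ⋄ Ω = a ∧ (b♯ ⌟ Ω) - b ∧ (a♯ ⌟ Ω)`. In components, it is the sum over the four slots of
`Ω` of the contraction of that slot with `α_{k}{}^{q} = ∑_p α_{kp} g^{pq}`. -/
def diamond (G : Matrix (Fin 8) (Fin 8) ℝ) (α : Fin 8 → Fin 8 → ℝ)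
    (W : Fin 8 → Fin 8 → Fin 8 → Fin 8 → ℝ) (k l m n : Fin 8) : ℝ :=
  ∑ p, ∑ q, G⁻¹ p q *
    (α k p * W q l m n + α l p * W k q m n + α m p * W k l q n + α n p * W k l m q)

/-- The inner product of two 2-forms. -/
def inner2 (G : Matrix (Fin 8) (Fin 8) ℝ) (α β : Fin 8 → Fin 8 → ℝ) : ℝ :=
  (1 / 2) * ∑ i, ∑ j, ∑ k, ∑ l, G⁻¹ i k * G⁻¹ j l * α i j * β k l

/-- Membership in `Λ²₁₅ = (𝔰𝔭(1) ⊕ 𝔰𝔭(2))^⊥ ⊆ Λ² ≅ 𝔰𝔬(8)`, where `𝔰𝔭(1) ⊕ 𝔰𝔭(2)` is the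
stabiliser algebra `{β | β ⋄ Ω = 0}` of the 4-form. -/
def IsLambda15 (G : Matrix (Fin 8) (Fin 8) ℝ) (W : Fin 8 → Fin 8 → Fin 8 → Fin 8 → ℝ)
    (α : Fin 8 → Fin 8 → ℝ) : Prop :=
  (∀ i j, α j i = -α i j) ∧
    ∀ β : Fin 8 → Fin 8 → ℝ, (∀ i j, β j i = -β i j) →
      (∀ k l m n, diamond G β W k l m n = 0) → inner2 G α β = 0

/-! ### Covariant derivatives on open subsets of `ℝ⁸`

Tensor fields on open subsets of `ℝ⁸` are given by their component functions. -/

/-- The partial derivative `∂_i φ` at `y`. -/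
def pderiv (i : Fin 8) (φ : E8 → ℝ) (y : E8) : ℝ := fderiv ℝ φ y (stdVec i)

/-- The Christoffel symbol `Γ^k_{ij}` of the Levi-Civita connection of the metric `G`. -/
def christoffel (G : E8 → Matrix (Fin 8) (Fin 8) ℝ) (y : E8) (k i j : Fin 8) : ℝ :=
  (1 / 2) * ∑ l, (G y)⁻¹ k l *
    (pderiv i (fun z => G z j l) y + pderiv j (fun z => G z i l) y - pderiv l (fun z => G z i j) y)

/-- The components `(∇_i Ω)_{klmn}` of the Levi-Civita derivative of a 4-form. -/
def nablaForm (G : E8 → Matrix (Fin 8) (Fin 8) ℝ)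
    (W : E8 → Fin 8 → Fin 8 → Fin 8 → Fin 8 → ℝ) (y : E8) (i k l m n : Fin 8) : ℝ :=
  pderiv i (fun z => W z k l m n) y -
    ∑ p, (christoffel G y p i k * W y p l m n + christoffel G y p i l * W y k p m n +
      christoffel G y p i m * W y k l p n + christoffel G y p i n * W y k l m p)

/-- The components `(∇_i T)_{ljk} = ((∇_{∂_i} T)(∂_l))_{jk}` of the Levi-Civita derivative of a
1-form `T` with values in 2-forms. -/
def nablaTorsion (G : E8 → Matrix (Fin 8) (Fin 8) ℝ) (T : E8 → Fin 8 → Fin 8 → Fin 8 → ℝ)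
    (y : E8) (i l j k : Fin 8) : ℝ :=
  pderiv i (fun z => T z l j k) y -
    ∑ p, (christoffel G y p i l * T y p j k + christoffel G y p i j * T y l p k +
      christoffel G y p i k * T y l j p)

/-- The divergence `div T = tr_g (∇ T)`, a 2-form. -/
def divTorsion (G : E8 → Matrix (Fin 8) (Fin 8) ℝ) (T : E8 → Fin 8 → Fin 8 → Fin 8 → ℝ)
    (y : E8) (j k : Fin 8) : ℝ :=
  ∑ i, ∑ l, (G y)⁻¹ i l * nablaTorsion G T y i l j k

/-- `t` is the intrinsic torsion at `y`: the 1-form with values in `Λ²₁₅` such that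
`∇_X Ω = t(X) ⋄ Ω` for all `X`. It is unique, `⋄ Ω` being injective on `Λ²₁₅`. -/
def IsIntrinsicTorsionAt (G : E8 → Matrix (Fin 8) (Fin 8) ℝ)
    (W : E8 → Fin 8 → Fin 8 → Fin 8 → Fin 8 → ℝ) (y : E8)
    (t : Fin 8 → Fin 8 → Fin 8 → ℝ) : Prop :=
  ∀ i, IsLambda15 (G y) (W y) (t i) ∧
    ∀ k l m n, nablaForm G W y i k l m n = diamond (G y) (t i) (W y) k l m n

/-! ### Structures on 8-manifolds -/

section Manifold

variable {M : Type*} [TopologicalSpace M] [ChartedSpace E8 M]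

/-- The coordinate vector `∂_i` of the chart `e`, at the point with coordinates `y`. -/
def coordVec (e : OpenPartialHomeomorph M E8) (y : E8) (i : Fin 8) :
    TangentSpace 𝓘(ℝ, E8) (e.symm y) :=
  mfderiv 𝓘(ℝ, E8) 𝓘(ℝ, E8) e.symm y (stdVec i)

/-- The components `g_{ij}` of `g` in the chart `e`. -/
def coordMetric
    (g : (x : M) → TangentSpace 𝓘(ℝ, E8) x →L[ℝ] TangentSpace 𝓘(ℝ, E8) x →L[ℝ] ℝ)
    (e : OpenPartialHomeomorph M E8) (y : E8) : Matrix (Fin 8) (Fin 8) ℝ :=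
  Matrix.of fun i j => g (e.symm y) (coordVec e y i) (coordVec e y j)

/-- The components `Ω_{ijkl}` of `Ω` in the chart `e`. -/
def coordForm (Ω : (x : M) → TangentSpace 𝓘(ℝ, E8) x [⋀^Fin 4]→L[ℝ] ℝ)
    (e : OpenPartialHomeomorph M E8) (y : E8) (i j k l : Fin 8) : ℝ :=
  Ω (e.symm y) ![coordVec e y i, coordVec e y j, coordVec e y k, coordVec e y l]

variable (M) in
/-- An `Sp(2)Sp(1)`-structure on an 8-manifold: a smooth 4-form `Ω` pointwise modelled on `Ω₀`,
together with the Riemannian metric that it determines. -/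
structure Sp2Sp1Structure [IsManifold 𝓘(ℝ, E8) ∞ M] where
  metric : Bundle.ContMDiffRiemannianMetric 𝓘(ℝ, E8) ∞ E8
    (fun x : M => TangentSpace 𝓘(ℝ, E8) x)
  form : (x : M) → TangentSpace 𝓘(ℝ, E8) x [⋀^Fin 4]→L[ℝ] ℝ
  smooth_form : ∀ e ∈ IsManifold.maximalAtlas 𝓘(ℝ, E8) ∞ M, ∀ i j k l,
    ContDiffOn ℝ ∞ (fun y => coordForm form e y i j k l) e.target
  adapted : ∀ x, IsAdapted (metric.inner x) (form x)

/-- The structure given by `Ω` and its metric `g` is torsion-free on `U`: its intrinsic torsion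
vanishes there. -/
def IsTorsionFreeOn (U : Set M)
    (g : (x : M) → TangentSpace 𝓘(ℝ, E8) x →L[ℝ] TangentSpace 𝓘(ℝ, E8) x →L[ℝ] ℝ)
    (Ω : (x : M) → TangentSpace 𝓘(ℝ, E8) x [⋀^Fin 4]→L[ℝ] ℝ) : Prop :=
  ∀ e ∈ IsManifold.maximalAtlas 𝓘(ℝ, E8) ∞ M, ∀ y ∈ e.target, e.symm y ∈ U →
    IsIntrinsicTorsionAt (coordMetric g e) (coordForm Ω e) y 0

variable [IsManifold 𝓘(ℝ, E8) ∞ M]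

/-- Locally there is a smooth function `f` such that `e^{-4f} Ω`, whose metric is `e^{-2f} g`, is
torsion-free. -/
def Sp2Sp1Structure.IsLocallyConformallyParallel (S : Sp2Sp1Structure M) : Prop :=
  ∀ x : M, ∃ U : Set M, IsOpen U ∧ x ∈ U ∧ ∃ f : M → ℝ,
    ContMDiffOn 𝓘(ℝ, E8) 𝓘(ℝ, ℝ) ∞ f U ∧
    IsTorsionFreeOn U (fun p => Real.exp (-2 * f p) • S.metric.inner p)
      (fun p => Real.exp (-4 * f p) • S.form p)

/-- The structure is harmonic: in every chart it has a smooth intrinsic torsion `T`, and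
`div T = 0`. By uniqueness of the intrinsic torsion the component functions `T` in the various
charts are those of one tensor field. -/
def Sp2Sp1Structure.IsHarmonic (S : Sp2Sp1Structure M) : Prop :=
  ∀ e ∈ IsManifold.maximalAtlas 𝓘(ℝ, E8) ∞ M, ∃ T : E8 → Fin 8 → Fin 8 → Fin 8 → ℝ,
    (∀ i j k, ContDiffOn ℝ ∞ (fun y => T y i j k) e.target) ∧
    ∀ y ∈ e.target,
      IsIntrinsicTorsionAt (coordMetric S.metric.inner e) (coordForm S.form e) y (T y) ∧
      ∀ j k, divTorsion (coordMetric S.metric.inner e) T y j k = 0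

end Manifold

end QK

end

noncomputable section

namespace QK

/-! Take everything with respect to the metric of the given structure, and put α(X) = X♭ ∧ df.
Passing from that metric to e^{-2f} times it changes the connection matrix in the direction X by
-df(X)·1 + α(X) (`connMat_conformal`). The scalar part cancels against the derivative of e^{-4f},
because the form has degree 4. So parallelism of the rescaled form says ∇_X Ω = α(X) ⋄ Ω
(`pderiv_form_of_nablaForm_eq_zero`). Hence T = π ∘ α, where π is the projection of 2-forms to Λ²₁₅.

The same equation says that the connection D = ∇ - α preserves Ω. It preserves the metric as well,
α(X) being skew. Since π is built from the metric and Ω alone, D commutes with it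
(`pderivMat_formProj`). With 2-forms regarded as skew endomorphisms this reads (∇_X T)(Y) = π((∇_X
α)(Y)) - π[α(X), α(Y)] + [α(X), π α(Y)]. The metric trace of each term vanishes. For the first, this
is the symmetry of the Hessian of f (`div_flatWedge`). For the second, a skew bracket is contracted
with a symmetric tensor. The third is `IsQuaternionic.sum_commutator`: π is a combination of the
identity, the conjugations b ↦ IbI and the terms tr(Ib)I, over a quaternionic triple. Both
contractions Σ gⁱˡ aᵢ I aₗ and Σ gⁱˡ tr(I aₗ) aᵢ are multiples of IF + FI with F = df ⊗ grad f, and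
IF + FI commutes with I because I² = -1.

Two descriptions of π are needed. `quatProj` uses a triple I, J, K and suits the algebra, but the
triple is chosen point by point. `formProj` is a polynomial in the contraction with Ω, so it is
smooth and can be differentiated. They agree on 2-forms (`IsQuaternionic.formProj_eq`). The function
f exists only locally; uniqueness of the intrinsic torsion (`IsIntrinsicTorsionAt.unique`) glues the
local results. -/

/-! ### Derivations acting on 4-tensors -/

/-- The derivation action of a matrix on a 4-tensor. -/
def actForm (A : Matrix (Fin 8) (Fin 8) ℝ) (W : Fin 8 → Fin 8 → Fin 8 → Fin 8 → ℝ)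
    (k l m n : Fin 8) : ℝ :=
  ∑ q, (A k q * W q l m n + A l q * W k q m n + A m q * W k l q n + A n q * W k l m q)

theorem diamond_eq_actForm (G : Matrix (Fin 8) (Fin 8) ℝ) (α : Fin 8 → Fin 8 → ℝ)
    (W : Fin 8 → Fin 8 → Fin 8 → Fin 8 → ℝ) (k l m n : Fin 8) :
    diamond G α W k l m n = actForm (Matrix.of α * G⁻¹) W k l m n := by
  unfold diamond actForm
  rw [Finset.sum_comm]
  refine Finset.sum_congr rfl fun q _ => ?_
  simp only [Matrix.mul_apply, Matrix.of_apply, Finset.sum_mul, ← Finset.sum_add_distrib]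
  exact Finset.sum_congr rfl fun p _ => by ring

theorem actForm_add (A B : Matrix (Fin 8) (Fin 8) ℝ)
    (W : Fin 8 → Fin 8 → Fin 8 → Fin 8 → ℝ) (k l m n : Fin 8) :
    actForm (A + B) W k l m n = actForm A W k l m n + actForm B W k l m n := by
  simp only [actForm, ← Finset.sum_add_distrib, Matrix.add_apply]
  exact Finset.sum_congr rfl fun q _ => by ring

theorem actForm_smul (c : ℝ) (A : Matrix (Fin 8) (Fin 8) ℝ)
    (W : Fin 8 → Fin 8 → Fin 8 → Fin 8 → ℝ) (k l m n : Fin 8) :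
    actForm (c • A) W k l m n = c * actForm A W k l m n := by
  simp only [actForm, Finset.mul_sum, Matrix.smul_apply, smul_eq_mul]
  exact Finset.sum_congr rfl fun q _ => by ring

theorem actForm_sub (A B : Matrix (Fin 8) (Fin 8) ℝ)
    (W : Fin 8 → Fin 8 → Fin 8 → Fin 8 → ℝ) (k l m n : Fin 8) :
    actForm (A - B) W k l m n = actForm A W k l m n - actForm B W k l m n := by
  rw [sub_eq_add_neg, actForm_add, ← neg_one_smul ℝ B, actForm_smul]
  ring

theorem actForm_one (W : Fin 8 → Fin 8 → Fin 8 → Fin 8 → ℝ) (k l m n : Fin 8) :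
    actForm 1 W k l m n = 4 * W k l m n := by
  simp only [actForm, Matrix.one_apply, Finset.sum_add_distrib, ite_mul, one_mul, zero_mul,
    Finset.sum_ite_eq, Finset.mem_univ, if_true]
  ring

theorem actForm_smul_form (c : ℝ) (A : Matrix (Fin 8) (Fin 8) ℝ)
    (W : Fin 8 → Fin 8 → Fin 8 → Fin 8 → ℝ) (k l m n : Fin 8) :
    actForm A (fun k l m n => c * W k l m n) k l m n = c * actForm A W k l m n := by
  simp only [actForm, Finset.mul_sum]
  exact Finset.sum_congr rfl fun q _ => by ring

/-- Half of the polarisation of the square of a 2-form. -/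
def wedge2 (X Y : Matrix (Fin 8) (Fin 8) ℝ) (k l m n : Fin 8) : ℝ :=
  X k l * Y m n - X k m * Y l n + X k n * Y l m

/-- Leibniz rule: the derivation given by `A` sends a 2-tensor `X` to `A * X + X * Aᵀ`. -/
theorem actForm_wedge2 (A X : Matrix (Fin 8) (Fin 8) ℝ) (k l m n : Fin 8) :
    actForm A (wedge2 X X) k l m n =
      wedge2 (A * X + X * Aᵀ) X k l m n + wedge2 X (A * X + X * Aᵀ) k l m n := by
  simp only [actForm, wedge2, Matrix.add_apply, Matrix.mul_apply, Matrix.transpose_apply,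
    add_mul, mul_add, Finset.sum_mul, Finset.mul_sum, ← Finset.sum_add_distrib,
    ← Finset.sum_sub_distrib]
  exact Finset.sum_congr rfl fun q _ => by ring

/-! ### Quaternionic triples and the operators built from them -/

/-- A metric and a 4-form given by a quaternionic triple of 2-forms. -/
structure IsQuaternionic (G : Matrix (Fin 8) (Fin 8) ℝ)
    (W : Fin 8 → Fin 8 → Fin 8 → Fin 8 → ℝ) (u v w : Matrix (Fin 8) (Fin 8) ℝ) : Prop where
  symm : Gᵀ = G
  isUnit : IsUnit G.det
  skew₁ : uᵀ = -u
  skew₂ : vᵀ = -v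
  skew₃ : wᵀ = -w
  sq₁ : u * G⁻¹ * (u * G⁻¹) = -1
  sq₂ : v * G⁻¹ * (v * G⁻¹) = -1
  mul₁₂ : u * G⁻¹ * (v * G⁻¹) = w * G⁻¹
  form : W = fun k l m n => wedge2 u u k l m n + wedge2 v v k l m n + wedge2 w w k l m n

/-- Generators of a quaternion algebra. -/
structure IsQuatTriple {R : Type*} [Ring R] (I J K : R) : Prop where
  ii : I * I = -1
  jj : J * J = -1
  kk : K * K = -1
  ij : I * J = K
  jk : J * K = I
  ki : K * I = J
  ji : J * I = -K
  kj : K * J = -I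
  ik : I * K = -J

/-- Cyclic symmetry: later statements are proved for `I` only and rotated to `J` and `K`. -/
theorem IsQuatTriple.rotate {R : Type*} [Ring R] {I J K : R} (h : IsQuatTriple I J K) :
    IsQuatTriple J K I :=
  ⟨h.jj, h.kk, h.ii, h.jk, h.ki, h.ij, h.kj, h.ik, h.ji⟩

/-- The projection to the complement of the stabiliser algebra of a quaternionic triple. -/
def quatProj (I J K b : Matrix (Fin 8) (Fin 8) ℝ) : Matrix (Fin 8) (Fin 8) ℝ :=
  (3 / 4 : ℝ) • b + (1 / 4 : ℝ) • (I * b * I + J * b * J + K * b * K) +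
    (1 / 8 : ℝ) • ((I * b).trace • I + (J * b).trace • J + (K * b).trace • K)

theorem quatProj_rotate (I J K b : Matrix (Fin 8) (Fin 8) ℝ) :
    quatProj J K I b = quatProj I J K b := by
  unfold quatProj
  congr 2
  · abel_nf
  · abel_nf

/-- The curvature-type operator of the 4-form of a quaternionic triple. -/
def quatOp (I J K b : Matrix (Fin 8) (Fin 8) ℝ) : Matrix (Fin 8) (Fin 8) ℝ :=
  (I * b * I + J * b * J + K * b * K) -
    (1 / 2 : ℝ) • ((I * b).trace • I + (J * b).trace • J + (K * b).trace • K)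

section Algebra

variable {I J K : Matrix (Fin 8) (Fin 8) ℝ}

theorem IsQuatTriple.trace_eq_zero (h : IsQuatTriple I J K) : I.trace = 0 := by
  have h1 : (J * K).trace = (K * J).trace := Matrix.trace_mul_comm _ _
  rw [h.jk, h.kj, Matrix.trace_neg] at h1
  linarith

theorem mul_mul_eq_of_mul_eq {R : Type*} [Semigroup R] {x y z : R} (h : x * y = z) (t : R) :
    x * (y * t) = z * t := by rw [← mul_assoc, h]

/-- Conjugation by the generators of a quaternion algebra. -/
def quatConj {R : Type*} [Ring R] (I J K b : R) : R := I * b * I + J * b * J + K * b * K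

/-- The quadratic relation x² = 3 - 2x leaves for real matrices only the eigenvalues -3, on the
commutant of the triple, and 1. -/
theorem IsQuatTriple.quatConj_quatConj {R : Type*} [Ring R] {I J K : R} (h : IsQuatTriple I J K)
    (b : R) :
    quatConj I J K (quatConj I J K b) = 3 * b - 2 * quatConj I J K b := by
  simp only [quatConj, mul_add, add_mul, mul_assoc, h.ii, h.jj, h.kk, h.ij, h.jk, h.ki, h.ji,
    h.kj, h.ik, mul_mul_eq_of_mul_eq h.ii, mul_mul_eq_of_mul_eq h.jj, mul_mul_eq_of_mul_eq h.kk,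
    mul_mul_eq_of_mul_eq h.ij, mul_mul_eq_of_mul_eq h.jk, mul_mul_eq_of_mul_eq h.ki,
    mul_mul_eq_of_mul_eq h.ji, mul_mul_eq_of_mul_eq h.kj, mul_mul_eq_of_mul_eq h.ik]
  noncomm_ring

theorem IsQuatTriple.quatConj_left {R : Type*} [Ring R] {I J K : R} (h : IsQuatTriple I J K) :
    quatConj I J K I = I := by
  simp only [quatConj, mul_assoc, h.ii, h.ij, h.ik]
  simp [h.jk, h.kj]

theorem quatConj_rotate {R : Type*} [Ring R] (I J K b : R) :
    quatConj J K I b = quatConj I J K b := by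
  unfold quatConj; abel

theorem trace_mul_quatConj (I J K a b : Matrix (Fin 8) (Fin 8) ℝ) :
    (a * quatConj I J K b).trace = (quatConj I J K a * b).trace := by
  have h (I : Matrix (Fin 8) (Fin 8) ℝ) : (a * (I * b * I)).trace = (I * a * I * b).trace := by
    rw [← mul_assoc, Matrix.trace_mul_comm]; simp only [mul_assoc]
  simp only [quatConj, mul_add, add_mul, Matrix.trace_add, h]

/-- The component of a matrix along the generators of a quaternion algebra. -/
def quatTrace (I J K b : Matrix (Fin 8) (Fin 8) ℝ) : Matrix (Fin 8) (Fin 8) ℝ :=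
  (I * b).trace • I + (J * b).trace • J + (K * b).trace • K

theorem quatTrace_rotate (I J K b : Matrix (Fin 8) (Fin 8) ℝ) :
    quatTrace J K I b = quatTrace I J K b := by
  unfold quatTrace; abel

theorem quatProj_eq (b : Matrix (Fin 8) (Fin 8) ℝ) : quatProj I J K b =
    (3 / 4 : ℝ) • b + (1 / 4 : ℝ) • quatConj I J K b + (1 / 8 : ℝ) • quatTrace I J K b := rfl

theorem quatOp_eq (b : Matrix (Fin 8) (Fin 8) ℝ) : quatOp I J K b =
    quatConj I J K b - (1 / 2 : ℝ) • quatTrace I J K b := rfl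

theorem quatConj_add {R : Type*} [Ring R] (I J K a b : R) :
    quatConj I J K (a + b) = quatConj I J K a + quatConj I J K b := by
  unfold quatConj; noncomm_ring

theorem quatConj_smul (c : ℝ) (b : Matrix (Fin 8) (Fin 8) ℝ) :
    quatConj I J K (c • b) = c • quatConj I J K b := by
  simp [quatConj, smul_add]

theorem quatTrace_add (a b : Matrix (Fin 8) (Fin 8) ℝ) :
    quatTrace I J K (a + b) = quatTrace I J K a + quatTrace I J K b := by
  simp only [quatTrace, mul_add, Matrix.trace_add, add_smul]; abel

theorem quatTrace_smul (c : ℝ) (b : Matrix (Fin 8) (Fin 8) ℝ) :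
    quatTrace I J K (c • b) = c • quatTrace I J K b := by
  simp [quatTrace, smul_add, smul_smul]

theorem IsQuatTriple.quatConj_quatTrace (h : IsQuatTriple I J K)
    (b : Matrix (Fin 8) (Fin 8) ℝ) :
    quatConj I J K (quatTrace I J K b) = quatTrace I J K b := by
  have h2 : quatConj I J K J = J := by rw [← quatConj_rotate, h.rotate.quatConj_left]
  have h3 : quatConj I J K K = K := by
    rw [← quatConj_rotate, ← quatConj_rotate, h.rotate.rotate.quatConj_left]
  conv_lhs => rw [quatTrace, quatConj_add, quatConj_add, quatConj_smul, quatConj_smul,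
    quatConj_smul, h.quatConj_left, h2, h3]
  rfl

/-- The generators are orthogonal for the trace form and tr I² = -8, so `-(1/8) • quatTrace`
projects to their span, the 𝔰𝔭(1) part. This is the origin of the coefficient 1/8 in `quatProj`. -/
theorem IsQuatTriple.quatTrace_left (h : IsQuatTriple I J K) :
    quatTrace I J K I = (-8 : ℝ) • I := by
  simp [quatTrace, h.ii, h.ji, h.ki, Matrix.trace_neg, h.rotate.rotate.trace_eq_zero,
    h.rotate.trace_eq_zero]

theorem IsQuatTriple.quatTrace_quatTrace (h : IsQuatTriple I J K)
    (b : Matrix (Fin 8) (Fin 8) ℝ) :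
    quatTrace I J K (quatTrace I J K b) = (-8 : ℝ) • quatTrace I J K b := by
  have h2 : quatTrace I J K J = (-8 : ℝ) • J := by
    rw [← quatTrace_rotate, h.rotate.quatTrace_left]
  have h3 : quatTrace I J K K = (-8 : ℝ) • K := by
    rw [← quatTrace_rotate, ← quatTrace_rotate, h.rotate.rotate.quatTrace_left]
  have h4 (x y z : ℝ) : quatTrace I J K (x • I + y • J + z • K) =
      (-8 : ℝ) • (x • I + y • J + z • K) := by
    rw [quatTrace_add, quatTrace_add, quatTrace_smul, quatTrace_smul, quatTrace_smul,
      h.quatTrace_left, h2, h3]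
    module
  exact h4 _ _ _

theorem IsQuatTriple.quatTrace_quatConj (h : IsQuatTriple I J K)
    (b : Matrix (Fin 8) (Fin 8) ℝ) :
    quatTrace I J K (quatConj I J K b) = quatTrace I J K b := by
  have h2 : quatConj I J K J = J := by rw [← quatConj_rotate, h.rotate.quatConj_left]
  have h3 : quatConj I J K K = K := by
    rw [← quatConj_rotate, ← quatConj_rotate, h.rotate.rotate.quatConj_left]
  rw [quatTrace, trace_mul_quatConj, trace_mul_quatConj, trace_mul_quatConj, h.quatConj_left,
    h2, h3, quatTrace]

/-- `quatOp` has eigenvalue -3 on the commutant of the triple, 5 on the span of the triple and 1 on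
the remaining part. The polynomial -(x + 3)(x - 5)/16 takes the values 0, 0, 1 there. -/
theorem IsQuatTriple.quatProj_eq_quatOp (h : IsQuatTriple I J K)
    (b : Matrix (Fin 8) (Fin 8) ℝ) :
    (15 / 16 : ℝ) • b + (1 / 8 : ℝ) • quatOp I J K b -
      (1 / 16 : ℝ) • quatOp I J K (quatOp I J K b) = quatProj I J K b := by
  have e (x y : Matrix (Fin 8) (Fin 8) ℝ) :
      x - (1 / 2 : ℝ) • y = x + (-1 / 2 : ℝ) • y := by module
  simp only [quatOp_eq, quatProj_eq, e, quatConj_add, quatTrace_add, quatConj_smul,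
    quatTrace_smul, h.quatConj_quatConj, h.quatConj_quatTrace, h.quatTrace_quatTrace,
    h.quatTrace_quatConj]
  have e3 : (3 : Matrix (Fin 8) (Fin 8) ℝ) * b = (3 : ℝ) • b := by
    rw [ofNat_smul_eq_nsmul ℝ 3 b, nsmul_eq_mul]; rfl
  have e2 : (2 : Matrix (Fin 8) (Fin 8) ℝ) * quatConj I J K b = (2 : ℝ) • quatConj I J K b := by
    rw [ofNat_smul_eq_nsmul ℝ 2 _, nsmul_eq_mul]; rfl
  rw [e3, e2]
  module

theorem IsQuatTriple.quatConj_quatProj (h : IsQuatTriple I J K) (b : Matrix (Fin 8) (Fin 8) ℝ) :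
    quatConj I J K (quatProj I J K b) = quatProj I J K b := by
  simp only [quatProj_eq, quatConj_add, quatConj_smul, h.quatConj_quatConj, h.quatConj_quatTrace]
  have e3 : (3 : Matrix (Fin 8) (Fin 8) ℝ) * b = (3 : ℝ) • b := by
    rw [ofNat_smul_eq_nsmul ℝ 3 b, nsmul_eq_mul]; rfl
  have e2 : (2 : Matrix (Fin 8) (Fin 8) ℝ) * quatConj I J K b = (2 : ℝ) • quatConj I J K b := by
    rw [ofNat_smul_eq_nsmul ℝ 2 _, nsmul_eq_mul]; rfl
  rw [e3, e2]
  module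

theorem IsQuatTriple.quatTrace_quatProj (h : IsQuatTriple I J K)
    (b : Matrix (Fin 8) (Fin 8) ℝ) : quatTrace I J K (quatProj I J K b) = 0 := by
  simp only [quatProj_eq, quatTrace_add, quatTrace_smul, h.quatTrace_quatConj,
    h.quatTrace_quatTrace]
  module

theorem IsQuatTriple.trace_mul_left_quatProj (h : IsQuatTriple I J K)
    (b : Matrix (Fin 8) (Fin 8) ℝ) : (I * quatProj I J K b).trace = 0 := by
  have h1 := congrArg (fun x => (I * x).trace) (h.quatTrace_quatProj b)
  simpa [quatTrace, mul_add, h.ii, h.ij, h.ik, Matrix.trace_neg,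
    h.rotate.rotate.trace_eq_zero, h.rotate.trace_eq_zero, Matrix.trace_one] using h1

theorem trace_mul_quatTrace (I J K a b : Matrix (Fin 8) (Fin 8) ℝ) :
    (a * quatTrace I J K b).trace = (quatTrace I J K a * b).trace := by
  simp only [quatTrace, mul_add, add_mul, Matrix.trace_add, Matrix.mul_smul, Matrix.smul_mul,
    Matrix.trace_smul, smul_eq_mul]
  rw [Matrix.trace_mul_comm a I, Matrix.trace_mul_comm a J, Matrix.trace_mul_comm a K]
  ring

/-- Self-adjointness for the trace form; this is what makes the image orthogonal to the kernel. -/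
theorem trace_mul_quatProj (I J K a b : Matrix (Fin 8) (Fin 8) ℝ) :
    (a * quatProj I J K b).trace = (quatProj I J K a * b).trace := by
  simp only [quatProj_eq, mul_add, add_mul, Matrix.trace_add, Matrix.mul_smul, Matrix.smul_mul,
    Matrix.trace_smul, trace_mul_quatConj, trace_mul_quatTrace]

/-- An element of the image of `quatProj` that commutes with the generators is zero. -/
theorem IsQuatTriple.eq_zero_of_commute (h : IsQuatTriple I J K)
    {c : Matrix (Fin 8) (Fin 8) ℝ} (hc : quatConj I J K c = c)
    (hI : c * I = I * c) (hJ : c * J = J * c) (hK : c * K = K * c) : c = 0 := by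
  rw [quatConj, mul_assoc, mul_assoc J, mul_assoc K, hI, hJ, hK, mul_mul_eq_of_mul_eq h.ii,
    mul_mul_eq_of_mul_eq h.jj, mul_mul_eq_of_mul_eq h.kk] at hc
  -- Commutation turns `quatConj` into multiplication by -3, against the assumed eigenvalue 1.
  have : (4 : ℝ) • c = 0 := by
    have h2 : (4 : ℝ) • c = c - (-1 * c + -1 * c + -1 * c) := by
      simp only [neg_mul, one_mul]; module
    rw [h2, hc, sub_self]
  simpa using this

/-- The generators commute with `b - quatConj I J K b`. -/
theorem IsQuatTriple.sub_quatConj_mul (h : IsQuatTriple I J K)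
    (b : Matrix (Fin 8) (Fin 8) ℝ) :
    (b - quatConj I J K b) * I = I * (b - quatConj I J K b) := by
  simp only [quatConj, mul_add, add_mul, mul_sub, sub_mul, mul_assoc, h.ii, h.ji, h.ki,
    mul_mul_eq_of_mul_eq h.ii, mul_mul_eq_of_mul_eq h.ij, mul_mul_eq_of_mul_eq h.ik]
  noncomm_ring

end Algebra

/-! ### The stabiliser algebra and Λ²₁₅ at a point -/

section Pointwise

variable {G u v w : Matrix (Fin 8) (Fin 8) ℝ} {W : Fin 8 → Fin 8 → Fin 8 → Fin 8 → ℝ}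

theorem mul_of_mul_mul_inv {G a b c : Matrix (Fin 8) (Fin 8) ℝ} (hG : IsUnit G.det)
    (h : a * G⁻¹ * (b * G⁻¹) = c * G⁻¹) : a * G⁻¹ * b = c := by
  have := congrArg (· * G) h
  simpa [mul_assoc, Matrix.nonsing_inv_mul _ hG] using this

theorem IsQuaternionic.inv_symm (h : IsQuaternionic G W u v w) : G⁻¹ᵀ = G⁻¹ := by
  rw [Matrix.transpose_nonsing_inv, h.symm]

/-- Transposing `I * J = K` and using that the three forms are skew gives `J * I = -K`; the other
products follow. -/
theorem IsQuaternionic.triple (h : IsQuaternionic G W u v w) :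
    IsQuatTriple (u * G⁻¹) (v * G⁻¹) (w * G⁻¹) := by
  have e := mul_of_mul_mul_inv h.isUnit h.mul₁₂
  have e2 := congrArg Matrix.transpose e
  rw [Matrix.transpose_mul, Matrix.transpose_mul, h.inv_symm, h.skew₁, h.skew₂, h.skew₃] at e2
  have ji : v * G⁻¹ * (u * G⁻¹) = -(w * G⁻¹) := by
    rw [← neg_mul, ← e2]; noncomm_ring
  have ij := h.mul₁₂
  have ii := h.sq₁
  have jj := h.sq₂
  set I := u * G⁻¹
  set J := v * G⁻¹
  set K := w * G⁻¹
  have ki : K * I = J := by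
    rw [← neg_neg K, ← ji, neg_mul, mul_assoc, ii]; simp
  have ik : I * K = -J := by rw [← ij, ← mul_assoc, ii]; simp
  have jk : J * K = I := by
    rw [← neg_neg K, ← ji, mul_neg, ← mul_assoc, jj]; simp
  have kj : K * J = -I := by rw [← ij, mul_assoc, jj]; simp
  have kk : K * K = -1 := by
    nth_rw 1 [← ij]; rw [mul_assoc, jk, ii]
  exact ⟨ii, jj, kk, ij, jk, ki, ji, kj, ik⟩

theorem IsQuaternionic.rotate (h : IsQuaternionic G W u v w) : IsQuaternionic G W v w u :=
  ⟨h.symm, h.isUnit, h.skew₂, h.skew₃, h.skew₁, h.sq₂, h.triple.kk, h.triple.jk, by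
    rw [h.form]; funext k l m n; ring⟩

theorem diamond_matrix (G α : Matrix (Fin 8) (Fin 8) ℝ)
    (W : Fin 8 → Fin 8 → Fin 8 → Fin 8 → ℝ) (k l m n : Fin 8) :
    diamond G (fun i j => α i j) W k l m n = actForm (α * G⁻¹) W k l m n :=
  diamond_eq_actForm G (fun i j => α i j) W k l m n

/-- The 2-form obtained from `X` by the derivation `b`. -/
theorem deriv_eq_commutator (h : IsQuaternionic G W u v w) {β X : Matrix (Fin 8) (Fin 8) ℝ}
    (hβ : βᵀ = -β) : β * G⁻¹ * X + X * (β * G⁻¹)ᵀ =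
      (β * G⁻¹ * (X * G⁻¹) - X * G⁻¹ * (β * G⁻¹)) * G := by
  rw [Matrix.transpose_mul, h.inv_symm, hβ, sub_mul]
  simp only [mul_assoc, Matrix.nonsing_inv_mul _ h.isUnit, mul_one]
  simp [sub_eq_add_neg]

theorem actForm_add_form (A : Matrix (Fin 8) (Fin 8) ℝ)
    (U V : Fin 8 → Fin 8 → Fin 8 → Fin 8 → ℝ) (k l m n : Fin 8) :
    actForm A (fun k l m n => U k l m n + V k l m n) k l m n =
      actForm A U k l m n + actForm A V k l m n := by
  simp only [actForm, ← Finset.sum_add_distrib]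
  exact Finset.sum_congr rfl fun q _ => by ring

theorem IsQuaternionic.actForm_eq (h : IsQuaternionic G W u v w)
    (A : Matrix (Fin 8) (Fin 8) ℝ) (k l m n : Fin 8) :
    actForm A W k l m n =
      (wedge2 (A * u + u * Aᵀ) u k l m n + wedge2 u (A * u + u * Aᵀ) k l m n) +
      (wedge2 (A * v + v * Aᵀ) v k l m n + wedge2 v (A * v + v * Aᵀ) k l m n) +
      (wedge2 (A * w + w * Aᵀ) w k l m n + wedge2 w (A * w + w * Aᵀ) k l m n) := by
  rw [h.form, actForm_add_form, actForm_add_form]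
  simp only [actForm_wedge2]

/-- The complementary part of `quatProj` stabilises the 4-form. -/
theorem IsQuaternionic.diamond_sub_quatProj (h : IsQuaternionic G W u v w)
    {β : Matrix (Fin 8) (Fin 8) ℝ} (hβ : βᵀ = -β) (b : Matrix (Fin 8) (Fin 8) ℝ)
    (e : β * G⁻¹ = b - quatProj (u * G⁻¹) (v * G⁻¹) (w * G⁻¹) b) (k l m n : Fin 8) :
    diamond G (fun i j => β i j) W k l m n = 0 := by
  have hq := h.triple
  rw [diamond_matrix, h.actForm_eq]
  rw [deriv_eq_commutator (X := u) h hβ, deriv_eq_commutator (X := v) h hβ,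
    deriv_eq_commutator (X := w) h hβ, e]
  have hu : u * G⁻¹ * G = u := by rw [mul_assoc, Matrix.nonsing_inv_mul _ h.isUnit, mul_one]
  have hv : v * G⁻¹ * G = v := by rw [mul_assoc, Matrix.nonsing_inv_mul _ h.isUnit, mul_one]
  have hw : w * G⁻¹ * G = w := by rw [mul_assoc, Matrix.nonsing_inv_mul _ h.isUnit, mul_one]
  set I := u * G⁻¹
  set J := v * G⁻¹
  set K := w * G⁻¹
  -- The first summand commutes with `I`, `J`, `K`. The second rotates them infinitesimally, and a
  -- sum of three squares is invariant under rotations.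
  have hb : b - quatProj I J K b =
      (1 / 4 : ℝ) • (b - quatConj I J K b) - (1 / 8 : ℝ) • quatTrace I J K b := by
    rw [quatProj_eq]; module
  have cI := hq.sub_quatConj_mul b
  have cJ := hq.rotate.sub_quatConj_mul b
  have cK := hq.rotate.rotate.sub_quatConj_mul b
  rw [quatConj_rotate] at cJ
  rw [quatConj_rotate, quatConj_rotate] at cK
  set s := b - quatConj I J K b
  rw [hb, quatTrace]
  set x := (I * b).trace
  set y := (J * b).trace
  set z := (K * b).trace
  have dI : ((1 / 4 : ℝ) • s - (1 / 8 : ℝ) • (x • I + y • J + z • K)) * I -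
      I * ((1 / 4 : ℝ) • s - (1 / 8 : ℝ) • (x • I + y • J + z • K)) =
        (y / 4) • K - (z / 4) • J := by
    simp only [sub_mul, mul_sub, add_mul, mul_add, smul_add, Matrix.smul_mul, Matrix.mul_smul, cI,
      hq.ji, hq.ki, hq.ij, hq.ik, hq.ii]
    module
  have dJ : ((1 / 4 : ℝ) • s - (1 / 8 : ℝ) • (x • I + y • J + z • K)) * J -
      J * ((1 / 4 : ℝ) • s - (1 / 8 : ℝ) • (x • I + y • J + z • K)) =
        (z / 4) • I - (x / 4) • K := by
    simp only [sub_mul, mul_sub, add_mul, mul_add, smul_add, Matrix.smul_mul, Matrix.mul_smul, cJ,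
      hq.ji, hq.kj, hq.ij, hq.jk, hq.jj]
    module
  have dK : ((1 / 4 : ℝ) • s - (1 / 8 : ℝ) • (x • I + y • J + z • K)) * K -
      K * ((1 / 4 : ℝ) • s - (1 / 8 : ℝ) • (x • I + y • J + z • K)) =
        (x / 4) • J - (y / 4) • I := by
    simp only [sub_mul, mul_sub, add_mul, mul_add, smul_add, Matrix.smul_mul, Matrix.mul_smul, cK,
      hq.ki, hq.kj, hq.ik, hq.jk, hq.kk]
    module
  rw [dI, dJ, dK]
  simp only [sub_mul, Matrix.smul_mul, hu, hv, hw, wedge2, Matrix.sub_apply, Matrix.smul_apply,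
    smul_eq_mul]
  ring

/-- Contraction of two indices of a 4-tensor with a bivector. -/
def contract2 (N : Matrix (Fin 8) (Fin 8) ℝ) (W : Fin 8 → Fin 8 → Fin 8 → Fin 8 → ℝ) :
    Matrix (Fin 8) (Fin 8) ℝ :=
  Matrix.of fun k l => ∑ m, ∑ n, W k l m n * N m n

theorem contract2_add (N : Matrix (Fin 8) (Fin 8) ℝ)
    (U V : Fin 8 → Fin 8 → Fin 8 → Fin 8 → ℝ) :
    contract2 N (fun k l m n => U k l m n + V k l m n) = contract2 N U + contract2 N V := by
  ext k l
  simp only [contract2, Matrix.of_apply, Matrix.add_apply, ← Finset.sum_add_distrib, add_mul]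

theorem contract2_wedge2 {N X Y : Matrix (Fin 8) (Fin 8) ℝ} (hN : Nᵀ = -N) (hY : Yᵀ = -Y) :
    contract2 N (wedge2 X Y) = (2 : ℝ) • (X * N * Y) - (Y * N).trace • X := by
  have h1 : contract2 N (wedge2 X Y) =
      (Yᵀ * N).trace • X - X * N * Yᵀ + X * Nᵀ * Yᵀ := by
    ext k l
    simp only [contract2, wedge2, Matrix.of_apply, Matrix.add_apply, Matrix.sub_apply,
      Matrix.smul_apply, Matrix.trace, Matrix.diag, Matrix.mul_apply, Matrix.transpose_apply,
      smul_eq_mul, Finset.sum_mul, add_mul, sub_mul, Finset.sum_add_distrib,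
      Finset.sum_sub_distrib]
    congr 1
    · congr 1
      · rw [Finset.sum_comm]
        exact Finset.sum_congr rfl fun _ _ => Finset.sum_congr rfl fun _ _ => by ring
      · rw [Finset.sum_comm]
        exact Finset.sum_congr rfl fun _ _ => Finset.sum_congr rfl fun _ _ => by ring
    · exact Finset.sum_congr rfl fun _ _ => Finset.sum_congr rfl fun _ _ => by ring
  rw [h1, hN, hY]
  simp only [mul_neg, neg_mul, neg_neg, Matrix.trace_neg]
  module

theorem contract2_wedge2_mul {N x y X Y : Matrix (Fin 8) (Fin 8) ℝ} (hG : IsUnit G.det)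
    (hN : (G⁻¹ * N)ᵀ = -(G⁻¹ * N)) (hX : Xᵀ = -X) (hY : Yᵀ = -Y)
    (eX : X = x * G) (eY : Y = y * G) :
    contract2 (G⁻¹ * N) (fun k l m n => wedge2 X Y k l m n + wedge2 Y X k l m n) =
      ((2 : ℝ) • (x * N * y + y * N * x) - (N * y).trace • x - (N * x).trace • y) * G := by
  have e1 (z : Matrix (Fin 8) (Fin 8) ℝ) : z * G * (G⁻¹ * N) = z * N := by
    rw [mul_assoc, ← mul_assoc G, Matrix.mul_nonsing_inv _ hG, one_mul]
  rw [contract2_add]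
  change contract2 (G⁻¹ * N) (wedge2 X Y) + contract2 (G⁻¹ * N) (wedge2 Y X) = _
  rw [contract2_wedge2 hN hY, contract2_wedge2 hN hX, eX, eY, e1, e1,
    Matrix.trace_mul_comm N, Matrix.trace_mul_comm N]
  simp only [sub_mul, smul_add, add_mul, Matrix.smul_mul, mul_assoc]
  abel

/-- Write c for the endomorphism of `β` and contract `β ⋄ W` with the bivector of `I`. The `u` term
gives 4[c, I]; the `v` and `w` terms together give another 4[c, I], as their mixed terms JcK + KcJ
cancel. The trace hypotheses remove the remaining multiples of `J` and `K`. -/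
theorem IsQuaternionic.commute_of_diamond_eq_zero (h : IsQuaternionic G W u v w)
    {β : Matrix (Fin 8) (Fin 8) ℝ} (hβ : βᵀ = -β)
    (hd : ∀ k l m n, diamond G (fun i j => β i j) W k l m n = 0)
    (tJ : (v * G⁻¹ * (β * G⁻¹)).trace = 0)
    (tK : (w * G⁻¹ * (β * G⁻¹)).trace = 0) :
    β * G⁻¹ * (u * G⁻¹) = u * G⁻¹ * (β * G⁻¹) := by
  have hq := h.triple
  have hN : (G⁻¹ * (u * G⁻¹))ᵀ = -(G⁻¹ * (u * G⁻¹)) := by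
    simp only [Matrix.transpose_mul, h.inv_symm, h.skew₁]; noncomm_ring
  have hu : u = u * G⁻¹ * G := by rw [mul_assoc, Matrix.nonsing_inv_mul _ h.isUnit, mul_one]
  have hv : v = v * G⁻¹ * G := by rw [mul_assoc, Matrix.nonsing_inv_mul _ h.isUnit, mul_one]
  have hw : w = w * G⁻¹ * G := by rw [mul_assoc, Matrix.nonsing_inv_mul _ h.isUnit, mul_one]
  have hskew {X : Matrix (Fin 8) (Fin 8) ℝ} (hX : Xᵀ = -X) :
      (β * G⁻¹ * X + X * (β * G⁻¹)ᵀ)ᵀ = -(β * G⁻¹ * X + X * (β * G⁻¹)ᵀ) := by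
    rw [Matrix.transpose_add, Matrix.transpose_mul, Matrix.transpose_mul X,
      Matrix.transpose_transpose, hX]
    noncomm_ring
  have key : contract2 (G⁻¹ * (u * G⁻¹))
      (fun k l m n => diamond G (fun i j => β i j) W k l m n) = 0 := by
    ext k l; simp [contract2, hd]
  simp only [diamond_matrix, h.actForm_eq] at key
  rw [contract2_add, contract2_add,
    contract2_wedge2_mul h.isUnit hN (hskew h.skew₁) h.skew₁ (deriv_eq_commutator h hβ) hu,
    contract2_wedge2_mul h.isUnit hN (hskew h.skew₂) h.skew₂ (deriv_eq_commutator h hβ) hv,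
    contract2_wedge2_mul h.isUnit hN (hskew h.skew₃) h.skew₃ (deriv_eq_commutator h hβ) hw]
    at key
  clear hu hv hw hskew hN
  set I := u * G⁻¹
  set J := v * G⁻¹
  set K := w * G⁻¹
  set c := β * G⁻¹
  rw [← add_mul, ← add_mul] at key
  replace key := congrArg (· * G⁻¹) key
  simp only [mul_assoc, Matrix.mul_nonsing_inv _ h.isUnit, zero_mul] at key
  have t1 : (I * (c * I)).trace = (I * (I * c)).trace := by
    rw [← mul_assoc, Matrix.trace_mul_comm]
  have t2 : (I * (c * J)).trace = (J * (I * c)).trace := by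
    rw [← mul_assoc, Matrix.trace_mul_comm]
  have t3 : (I * (c * K)).trace = (K * (I * c)).trace := by
    rw [← mul_assoc, Matrix.trace_mul_comm]
  simp only [mul_sub, sub_mul, Matrix.trace_sub, mul_assoc, t1, t2, t3, hq.ii,
    hq.ij, hq.jk, hq.kj, hq.ik, mul_mul_eq_of_mul_eq hq.ii,
    mul_mul_eq_of_mul_eq hq.ij, mul_mul_eq_of_mul_eq hq.jk, mul_mul_eq_of_mul_eq hq.ki,
    mul_mul_eq_of_mul_eq hq.ji, mul_mul_eq_of_mul_eq hq.kj, mul_mul_eq_of_mul_eq hq.ik,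
    neg_mul, mul_neg, Matrix.trace_neg, tJ, tK, hq.rotate.trace_eq_zero,
    hq.rotate.rotate.trace_eq_zero, Matrix.trace_one, one_mul, mul_one, Fintype.card_fin] at key
  have : (8 : ℝ) • (c * I - I * c) = 0 := by
    rw [← key]
    push_cast
    module
  rw [← sub_eq_zero]
  simpa using this

theorem IsQuaternionic.quatProj_skew (h : IsQuaternionic G W u v w)
    {β : Matrix (Fin 8) (Fin 8) ℝ} (hβ : βᵀ = -β) :
    (quatProj (u * G⁻¹) (v * G⁻¹) (w * G⁻¹) (β * G⁻¹) * G)ᵀ =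
      -(quatProj (u * G⁻¹) (v * G⁻¹) (w * G⁻¹) (β * G⁻¹) * G) := by
  have e (X : Matrix (Fin 8) (Fin 8) ℝ) : X * G⁻¹ * G = X := by
    rw [mul_assoc, Matrix.nonsing_inv_mul _ h.isUnit, mul_one]
  have e2 : G⁻¹ * G = 1 := Matrix.nonsing_inv_mul _ h.isUnit
  simp only [quatProj, add_mul, Matrix.smul_mul, mul_assoc, e2, mul_one, Matrix.transpose_add,
    Matrix.transpose_smul, Matrix.transpose_mul, h.skew₁, h.skew₂, h.skew₃, hβ, h.inv_symm,
    neg_mul, mul_neg]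
  module

/-- `quatProj` vanishes on the stabiliser algebra of the 4-form. -/
theorem IsQuaternionic.quatProj_eq_zero (h : IsQuaternionic G W u v w)
    {β : Matrix (Fin 8) (Fin 8) ℝ} (hβ : βᵀ = -β)
    (hd : ∀ k l m n, diamond G (fun i j => β i j) W k l m n = 0) :
    quatProj (u * G⁻¹) (v * G⁻¹) (w * G⁻¹) (β * G⁻¹) = 0 := by
  have hq := h.triple
  set γ := quatProj (u * G⁻¹) (v * G⁻¹) (w * G⁻¹) (β * G⁻¹) * G with hγ
  have eγ : γ * G⁻¹ = quatProj (u * G⁻¹) (v * G⁻¹) (w * G⁻¹) (β * G⁻¹) := by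
    rw [hγ, mul_assoc, Matrix.mul_nonsing_inv _ h.isUnit, mul_one]
  have sγ : γᵀ = -γ := h.quatProj_skew hβ
  -- Both `β` and its complementary part `β - γ` stabilise the form, hence so does `γ`.
  have dγ (k l m n : Fin 8) : diamond G (fun i j => γ i j) W k l m n = 0 := by
    have h1 : diamond G (fun i j => (β - γ) i j) W k l m n = 0 :=
      h.diamond_sub_quatProj (by rw [Matrix.transpose_sub, hβ, sγ]; abel) (β * G⁻¹)
        (by rw [sub_mul, eγ]) k l m n
    have h2 := hd k l m n
    rw [diamond_matrix] at h1 h2 ⊢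
    rw [sub_mul, actForm_sub, h2] at h1
    linarith
  have tI : (u * G⁻¹ * (γ * G⁻¹)).trace = 0 := by rw [eγ]; exact hq.trace_mul_left_quatProj _
  have tJ : (v * G⁻¹ * (γ * G⁻¹)).trace = 0 := by
    rw [eγ, ← quatProj_rotate]; exact hq.rotate.trace_mul_left_quatProj _
  have tK : (w * G⁻¹ * (γ * G⁻¹)).trace = 0 := by
    rw [eγ, ← quatProj_rotate, ← quatProj_rotate]
    exact hq.rotate.rotate.trace_mul_left_quatProj _
  rw [← eγ]
  -- Being trace-free against the triple, the endomorphism of `γ` commutes with it; but it is also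
  -- fixed by `quatConj`.
  refine hq.eq_zero_of_commute ?_ (h.commute_of_diamond_eq_zero sγ dγ tJ tK)
    (h.rotate.commute_of_diamond_eq_zero sγ dγ tK tI)
    (h.rotate.rotate.commute_of_diamond_eq_zero sγ dγ tI tJ)
  rw [eγ]
  exact hq.quatConj_quatProj _

theorem inner2_eq_trace (hG : G⁻¹ᵀ = G⁻¹) {α β : Matrix (Fin 8) (Fin 8) ℝ} (hβ : βᵀ = -β) :
    inner2 G (fun i j => α i j) (fun i j => β i j) =
      -(1 / 2) * (α * G⁻¹ * (β * G⁻¹)).trace := by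
  have h1 : (α * G⁻¹ * (β * G⁻¹)).trace = -(α * G⁻¹ * βᵀ * G⁻¹ᵀ).trace := by
    rw [hβ, hG]; simp [mul_assoc]
  rw [h1, inner2]
  simp only [Matrix.trace, Matrix.diag, Matrix.mul_apply, Matrix.transpose_apply, Finset.sum_mul]
  have h2 : ∑ i, ∑ j, ∑ k, ∑ l, G⁻¹ i k * G⁻¹ j l * α i j * β k l =
      ∑ x, ∑ i, ∑ j, ∑ k, α x k * G⁻¹ k j * β i j * G⁻¹ x i := by
    refine Finset.sum_congr rfl fun i _ => ?_
    rw [Finset.sum_comm]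
    refine Finset.sum_congr rfl fun k _ => ?_
    rw [Finset.sum_comm]
    exact Finset.sum_congr rfl fun l _ => Finset.sum_congr rfl fun j _ => by ring
  rw [h2]
  ring

/-- The image of `quatProj` lies in `Λ²₁₅`. -/
theorem IsQuaternionic.isLambda15 (h : IsQuaternionic G W u v w)
    {α : Matrix (Fin 8) (Fin 8) ℝ} (hα : αᵀ = -α) :
    IsLambda15 G W
      fun i j => (quatProj (u * G⁻¹) (v * G⁻¹) (w * G⁻¹) (α * G⁻¹) * G) i j := by
  refine ⟨fun i j => congrFun (congrFun (h.quatProj_skew hα) i) j, fun β hβ hd => ?_⟩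
  have hβ' : (Matrix.of β)ᵀ = -Matrix.of β := by ext i j; exact hβ i j
  have e := inner2_eq_trace h.inv_symm hβ'
    (α := quatProj (u * G⁻¹) (v * G⁻¹) (w * G⁻¹) (α * G⁻¹) * G)
  simp only [Matrix.of_apply] at e
  rw [e, mul_assoc _ G, Matrix.mul_nonsing_inv _ h.isUnit, mul_one, ← trace_mul_quatProj,
    h.quatProj_eq_zero hβ' hd]
  simp

/-- Only a stabilising part is discarded. So any 2-form with the right action on `W` yields the
torsion after projection. -/
theorem IsQuaternionic.diamond_quatProj (h : IsQuaternionic G W u v w)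
    {α : Matrix (Fin 8) (Fin 8) ℝ} (hα : αᵀ = -α) (k l m n : Fin 8) :
    diamond G (fun i j => (quatProj (u * G⁻¹) (v * G⁻¹) (w * G⁻¹) (α * G⁻¹) * G) i j) W k l m n =
      diamond G (fun i j => α i j) W k l m n := by
  have h1 := h.diamond_sub_quatProj
    (β := α - quatProj (u * G⁻¹) (v * G⁻¹) (w * G⁻¹) (α * G⁻¹) * G)
    (by rw [Matrix.transpose_sub, hα, h.quatProj_skew hα]; abel) (α * G⁻¹)
    (by rw [sub_mul, mul_assoc _ G, Matrix.mul_nonsing_inv _ h.isUnit, mul_one]) k l m n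
  rw [diamond_matrix] at h1 ⊢
  rw [sub_mul, actForm_sub] at h1
  rw [diamond_matrix]
  linarith

end Pointwise

/-! ### Contractions of the 2-forms e_i♭ ∧ f -/

section Casimir

variable {G u v w : Matrix (Fin 8) (Fin 8) ℝ} {W : Fin 8 → Fin 8 → Fin 8 → Fin 8 → ℝ}

/-- The 2-form `e_i♭ ∧ f`. -/
def flatWedge (G : Matrix (Fin 8) (Fin 8) ℝ) (f : Fin 8 → ℝ) (i : Fin 8) :
    Matrix (Fin 8) (Fin 8) ℝ :=
  Matrix.of fun k p => G i k * f p - f k * G i p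

theorem flatWedge_transpose (G : Matrix (Fin 8) (Fin 8) ℝ) (f : Fin 8 → ℝ) (i : Fin 8) :
    (flatWedge G f i)ᵀ = -flatWedge G f i := by
  ext k p; simp [flatWedge]; ring

/-- A difference of two rank-one matrices, which makes the sums over the frame explicit. -/
theorem flatWedge_mul_inv (hG : IsUnit G.det) (f : Fin 8 → ℝ) (i : Fin 8) :
    flatWedge G f i * G⁻¹ =
      Matrix.vecMulVec (G.row i) (f ᵥ* G⁻¹) - Matrix.vecMulVec f (Pi.single i 1) := by
  have h : flatWedge G f i = Matrix.vecMulVec (G.row i) f - Matrix.vecMulVec f (G.row i) := by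
    ext k p; simp [flatWedge, Matrix.vecMulVec_apply]
  have h2 : G.row i ᵥ* G⁻¹ = Pi.single i 1 := by
    ext j
    have := congrFun (congrFun (Matrix.mul_nonsing_inv _ hG) i) j
    rw [Matrix.mul_apply, Matrix.one_apply] at this
    simp only [Matrix.vecMul, dotProduct, Matrix.row_apply, this, Pi.single_apply, eq_comm]
  rw [h, sub_mul, Matrix.vecMulVec_mul, Matrix.vecMulVec_mul, h2]

/-- The four terms are the products of the rank-one pieces, with the frame and its dual contracted.
-/
theorem sum_flatWedge_mul (hG : IsUnit G.det) (hs : Gᵀ = G) (f : Fin 8 → ℝ)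
    (M : Matrix (Fin 8) (Fin 8) ℝ) :
    ∑ i, ∑ l, G⁻¹ i l • (flatWedge G f i * G⁻¹ * M * (flatWedge G f l * G⁻¹)) =
      Matrix.vecMulVec ((f ᵥ* G⁻¹) ᵥ* (M * G)) (f ᵥ* G⁻¹) - ((f ᵥ* G⁻¹) ⬝ᵥ (M *ᵥ f)) • 1 -
      M.trace • Matrix.vecMulVec f (f ᵥ* G⁻¹) + Matrix.vecMulVec f (G⁻¹ *ᵥ (M *ᵥ f)) := by
  have hb (l : Fin 8) : ∑ i, G⁻¹ i l • (flatWedge G f i * G⁻¹) =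
      Matrix.vecMulVec (Pi.single l 1) (f ᵥ* G⁻¹) - Matrix.vecMulVec f (G⁻¹.row l) := by
    have hs' (i j : Fin 8) : G⁻¹ i j = G⁻¹ j i := by
      have : G⁻¹ᵀ = G⁻¹ := by rw [Matrix.transpose_nonsing_inv, hs]
      exact congrFun (congrFun this j) i
    have h1 (k : Fin 8) : ∑ i, G⁻¹ i l * G i k = if l = k then 1 else 0 := by
      have := congrFun (congrFun (Matrix.nonsing_inv_mul G hG) l) k
      rw [Matrix.mul_apply, Matrix.one_apply] at this
      rw [← this]
      exact Finset.sum_congr rfl fun i _ => by rw [hs']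
    ext k p
    simp only [flatWedge_mul_inv hG, Matrix.sum_apply, Matrix.smul_apply, Matrix.sub_apply,
      Matrix.vecMulVec_apply, Matrix.row_apply, smul_eq_mul, mul_sub, Finset.sum_sub_distrib,
      ← mul_assoc, ← Finset.sum_mul, h1]
    congr 1
    · simp [Pi.single_apply, eq_comm]
    · simp only [Pi.single_apply, mul_ite, mul_one, mul_zero, Finset.sum_ite_eq, Finset.mem_univ,
        if_true]
      rw [hs' p l, mul_comm]
  have hl : ∑ i, ∑ l, G⁻¹ i l • (flatWedge G f i * G⁻¹ * M * (flatWedge G f l * G⁻¹)) =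
      ∑ l, (Matrix.vecMulVec (Pi.single l 1) (f ᵥ* G⁻¹) - Matrix.vecMulVec f (G⁻¹.row l)) * M *
        (Matrix.vecMulVec (G.row l) (f ᵥ* G⁻¹) - Matrix.vecMulVec f (Pi.single l 1)) := by
    rw [Finset.sum_comm]
    refine Finset.sum_congr rfl fun l _ => ?_
    rw [← hb, ← flatWedge_mul_inv hG, Finset.sum_mul, Finset.sum_mul]
    simp only [Matrix.smul_mul]
  have h1 (l : Fin 8) : (f ᵥ* G⁻¹) ᵥ* M ⬝ᵥ G.row l = ((f ᵥ* G⁻¹) ᵥ* (M * G)) l := by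
    rw [← Matrix.vecMul_vecMul]
    have e (x : Fin 8 → ℝ) : x ᵥ* G = G *ᵥ x := by rw [← Matrix.vecMul_transpose, hs]
    rw [e, Matrix.mulVec, dotProduct_comm]
    rfl
  have h2 : ∑ l, G⁻¹.row l ᵥ* M ⬝ᵥ G.row l = M.trace := by
    have : (G⁻¹ * M * Gᵀ).trace = M.trace := by
      rw [hs, mul_assoc, Matrix.trace_mul_comm, mul_assoc, Matrix.mul_nonsing_inv _ hG, mul_one]
    rw [← this]
    simp only [Matrix.trace, Matrix.diag_apply, Matrix.mul_apply, Matrix.transpose_apply,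
      Matrix.row_apply, dotProduct, Matrix.vecMul]
  have h3 (l : Fin 8) : G⁻¹.row l ᵥ* M ⬝ᵥ f = (G⁻¹ *ᵥ (M *ᵥ f)) l := by
    rw [← Matrix.dotProduct_mulVec, Matrix.mulVec]
    rfl
  rw [hl, ← h2, Matrix.dotProduct_mulVec]
  simp only [sub_mul, mul_sub, Matrix.vecMulVec_mul, Matrix.vecMul_vecMulVec]
  simp only [h1, h3]
  ext k p
  simp only [Matrix.sum_apply, Matrix.sub_apply, Matrix.add_apply, Matrix.smul_apply,
    Matrix.vecMulVec_apply, Pi.smul_apply, smul_eq_mul, Pi.single_apply, Matrix.one_apply,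
    Finset.sum_sub_distrib, mul_ite, ite_mul, one_mul, zero_mul, mul_one, mul_zero,
    Finset.sum_ite_eq, Finset.mem_univ, if_true, Finset.sum_mul]
  have : ∑ l, f k * ((G⁻¹.row l ᵥ* M ⬝ᵥ G.row l) * (f ᵥ* G⁻¹) p) =
    ∑ l, (G⁻¹.row l ᵥ* M ⬝ᵥ G.row l) * (f k * (f ᵥ* G⁻¹) p) :=
      Finset.sum_congr rfl fun l _ => by ring
  rw [this]
  by_cases hkp : k = p
  · simp [hkp]
    ring
  · simp [hkp]

theorem sum_comm_flatWedge (hs : Gᵀ = G) (F : Fin 8 → Fin 8 → Matrix (Fin 8) (Fin 8) ℝ) :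
    ∑ i, ∑ l, G⁻¹ i l • F i l = ∑ i, ∑ l, G⁻¹ i l • F l i := by
  have hs' (i j : Fin 8) : G⁻¹ i j = G⁻¹ j i := by
    have : G⁻¹ᵀ = G⁻¹ := by rw [Matrix.transpose_nonsing_inv, hs]
    exact congrFun (congrFun this j) i
  rw [Finset.sum_comm]
  exact Finset.sum_congr rfl fun i _ => Finset.sum_congr rfl fun l _ => by rw [hs']

/-- For `M = u * G⁻¹` with `u` skew, the scalar term and the trace term vanish and the other two
form an anticommutator. -/
theorem sum_flatWedge_mul_skew (hG : IsUnit G.det) (hs : Gᵀ = G) (hu : uᵀ = -u)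
    (ht : (u * G⁻¹).trace = 0) (f : Fin 8 → ℝ) :
    ∑ i, ∑ l, G⁻¹ i l • (flatWedge G f i * G⁻¹ * (u * G⁻¹) * (flatWedge G f l * G⁻¹)) =
      -(u * G⁻¹ * Matrix.vecMulVec f (f ᵥ* G⁻¹) + Matrix.vecMulVec f (f ᵥ* G⁻¹) * (u * G⁻¹)) := by
  have hi : G⁻¹ᵀ = G⁻¹ := by rw [Matrix.transpose_nonsing_inv, hs]
  have h1 : (f ᵥ* G⁻¹) ᵥ* (u * G⁻¹ * G) = -((u * G⁻¹) *ᵥ f) := by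
    rw [mul_assoc, Matrix.nonsing_inv_mul _ hG, mul_one, Matrix.vecMul_vecMul,
      ← Matrix.mulVec_transpose, Matrix.transpose_mul, hu, hi, neg_mul, Matrix.neg_mulVec]
  have h2 : G⁻¹ *ᵥ ((u * G⁻¹) *ᵥ f) = -((f ᵥ* G⁻¹) ᵥ* (u * G⁻¹)) := by
    rw [Matrix.vecMul_vecMul, ← Matrix.mulVec_transpose, Matrix.transpose_mul,
      Matrix.transpose_mul, hu, hi, Matrix.mulVec_mulVec, ← Matrix.neg_mulVec]
    congr 1
    noncomm_ring
  have h3 : (f ᵥ* G⁻¹) ⬝ᵥ ((u * G⁻¹) *ᵥ f) = 0 := by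
    have e1 : (f ᵥ* G⁻¹) ⬝ᵥ ((u * G⁻¹) *ᵥ f) = f ⬝ᵥ (G⁻¹ *ᵥ ((u * G⁻¹) *ᵥ f)) := by
      rw [← Matrix.dotProduct_mulVec]
    have e2 : f ⬝ᵥ ((f ᵥ* G⁻¹) ᵥ* (u * G⁻¹)) = (f ᵥ* G⁻¹) ⬝ᵥ ((u * G⁻¹) *ᵥ f) := by
      rw [dotProduct_comm, ← Matrix.dotProduct_mulVec]
    rw [h2, dotProduct_neg, e2] at e1
    linarith
  rw [sum_flatWedge_mul hG hs, h1, h2, h3, ht, Matrix.mul_vecMulVec, Matrix.vecMulVec_mul,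
    Matrix.neg_vecMulVec, Matrix.vecMulVec_neg]
  simp only [zero_smul]
  abel

/-- The anticommutator of `sum_flatWedge_mul_skew` reappears, so one commutation argument handles
both kinds of terms in `quatProj`. -/
theorem sum_trace_flatWedge (hG : IsUnit G.det) (hs : Gᵀ = G) (hu : uᵀ = -u) (f : Fin 8 → ℝ) :
    ∑ i, ∑ l, G⁻¹ i l • ((u * G⁻¹ * (flatWedge G f l * G⁻¹)).trace • (flatWedge G f i * G⁻¹)) =
      (-2 : ℝ) • (u * G⁻¹ * Matrix.vecMulVec f (f ᵥ* G⁻¹) +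
        Matrix.vecMulVec f (f ᵥ* G⁻¹) * (u * G⁻¹)) := by
  have hi : G⁻¹ᵀ = G⁻¹ := by rw [Matrix.transpose_nonsing_inv, hs]
  have ht (l : Fin 8) : (u * G⁻¹ * (flatWedge G f l * G⁻¹)).trace =
      -2 * ((u * G⁻¹) *ᵥ f) l := by
    have e1 : (u * G⁻¹) *ᵥ G.row l ⬝ᵥ (f ᵥ* G⁻¹) = -((u * G⁻¹) *ᵥ f) l := by
      have e (x : Fin 8 → ℝ) : x ᵥ* G = G *ᵥ x := by rw [← Matrix.vecMul_transpose, hs]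
      have e2 : ((f ᵥ* G⁻¹) ᵥ* (u * G⁻¹)) ⬝ᵥ G.row l = (((f ᵥ* G⁻¹) ᵥ* (u * G⁻¹)) ᵥ* G) l := by
        rw [e, Matrix.mulVec, dotProduct_comm]
        rfl
      rw [dotProduct_comm, Matrix.dotProduct_mulVec, e2, Matrix.vecMul_vecMul, mul_assoc,
        Matrix.nonsing_inv_mul _ hG, mul_one, Matrix.vecMul_vecMul, ← Matrix.mulVec_transpose,
        Matrix.transpose_mul, hu, hi, neg_mul, Matrix.neg_mulVec, Pi.neg_apply]
    rw [flatWedge_mul_inv hG, mul_sub, Matrix.trace_sub, Matrix.mul_vecMulVec,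
      Matrix.mul_vecMulVec, Matrix.trace_vecMulVec, Matrix.trace_vecMulVec, e1]
    simp
    ring
  have h2 : G⁻¹ *ᵥ ((u * G⁻¹) *ᵥ f) = -((f ᵥ* G⁻¹) ᵥ* (u * G⁻¹)) := by
    rw [Matrix.vecMul_vecMul, ← Matrix.mulVec_transpose, Matrix.transpose_mul,
      Matrix.transpose_mul, hu, hi, Matrix.mulVec_mulVec, ← Matrix.neg_mulVec]
    congr 1
    noncomm_ring
  set x := (u * G⁻¹) *ᵥ f with hx
  have h4 : ∑ i, ∑ l, G⁻¹ i l • ((-2 * x l) • (flatWedge G f i * G⁻¹)) =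
      (-2 : ℝ) • ∑ i, (G⁻¹ *ᵥ x) i • (flatWedge G f i * G⁻¹) := by
    rw [Finset.smul_sum]
    refine Finset.sum_congr rfl fun i _ => ?_
    simp only [Matrix.mulVec, dotProduct, Finset.sum_smul, Finset.smul_sum, smul_smul]
    exact Finset.sum_congr rfl fun l _ => by congr 1; ring
  have h5 (y : Fin 8 → ℝ) : ∑ i, y i • (flatWedge G f i * G⁻¹) =
      Matrix.vecMulVec (y ᵥ* G) (f ᵥ* G⁻¹) - Matrix.vecMulVec f y := by
    ext k p
    simp only [flatWedge_mul_inv hG, Matrix.sum_apply, Matrix.sub_apply, Matrix.smul_apply,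
      Matrix.vecMulVec_apply, smul_eq_mul, mul_sub, Finset.sum_sub_distrib, Matrix.row_apply,
      Pi.single_apply, mul_ite, mul_one, mul_zero, Finset.sum_ite_eq, Finset.mem_univ, if_true]
    congr 1
    · have e : (y ᵥ* G) k = ∑ i, y i * G i k := rfl
      rw [e, Finset.sum_mul]
      exact Finset.sum_congr rfl fun i _ => by ring
    · ring
  have h6 : (G⁻¹ *ᵥ x) ᵥ* G = x := by
    rw [← Matrix.vecMul_transpose, hi, Matrix.vecMul_vecMul, Matrix.nonsing_inv_mul _ hG,
      Matrix.vecMul_one]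
  simp only [ht]
  rw [h4, h5, h6, h2, Matrix.vecMulVec_neg, Matrix.mul_vecMulVec, Matrix.vecMulVec_mul, ← hx,
    sub_neg_eq_add]

/-- Casimir-type identity for the projection to `Λ²₁₅`. -/
theorem IsQuaternionic.sum_commutator (h : IsQuaternionic G W u v w) (f : Fin 8 → ℝ) :
    ∑ i, ∑ l, G⁻¹ i l • (flatWedge G f i * G⁻¹ *
        quatProj (u * G⁻¹) (v * G⁻¹) (w * G⁻¹) (flatWedge G f l * G⁻¹) -
      quatProj (u * G⁻¹) (v * G⁻¹) (w * G⁻¹) (flatWedge G f l * G⁻¹) *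
        (flatWedge G f i * G⁻¹)) = 0 := by
  set a := fun i => flatWedge G f i * G⁻¹ with ha
  change ∑ i, ∑ l, G⁻¹ i l • (a i * quatProj (u * G⁻¹) (v * G⁻¹) (w * G⁻¹) (a l) -
      quatProj (u * G⁻¹) (v * G⁻¹) (w * G⁻¹) (a l) * a i) = 0
  have h0 : ∑ i, ∑ l, G⁻¹ i l • (a i * a l - a l * a i) = 0 := by
    simp only [smul_sub, Finset.sum_sub_distrib]
    rw [sum_comm_flatWedge h.symm, sub_self]
  have main {u v w : Matrix (Fin 8) (Fin 8) ℝ} (h : IsQuaternionic G W u v w) :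
      ∑ i, ∑ l, G⁻¹ i l • (a i * (u * G⁻¹ * a l * (u * G⁻¹)) -
        u * G⁻¹ * a l * (u * G⁻¹) * a i) = 0 ∧
      ∑ i, ∑ l, G⁻¹ i l • ((u * G⁻¹ * a l).trace • (a i * (u * G⁻¹) - u * G⁻¹ * a i)) = 0 := by
    have hq := h.triple
    have e1 := sum_flatWedge_mul_skew h.isUnit h.symm h.skew₁ hq.trace_eq_zero f
    have e2 := sum_trace_flatWedge h.isUnit h.symm h.skew₁ f
    set I := u * G⁻¹
    set F := Matrix.vecMulVec f (f ᵥ* G⁻¹)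
    -- Both sides equal `I * F * I - F`.
    have c : (I * F + F * I) * I = I * (I * F + F * I) := by
      rw [add_mul, mul_add, mul_assoc F, hq.ii, ← mul_assoc I I, hq.ii, mul_assoc]
      noncomm_ring
    constructor
    -- The sum is SI - IS, where S = Σ gⁱˡ aᵢ I aₗ is unchanged by swapping the indices and commutes
    -- with `I`.
    · have e3 := e1
      rw [sum_comm_flatWedge h.symm] at e3
      have : ∑ i, ∑ l, G⁻¹ i l • (a i * (I * a l * I) - I * a l * I * a i) =
          (∑ i, ∑ l, G⁻¹ i l • (a i * I * a l)) * I -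
            I * ∑ i, ∑ l, G⁻¹ i l • (a l * I * a i) := by
        simp only [Finset.sum_mul, Finset.mul_sum, ← Finset.sum_sub_distrib, Matrix.smul_mul,
          Matrix.mul_smul, ← smul_sub, mul_assoc]
      rw [this, e1, e3, neg_mul, c, mul_neg, sub_self]
    · have : ∑ i, ∑ l, G⁻¹ i l • ((I * a l).trace • (a i * I - I * a i)) =
          (∑ i, ∑ l, G⁻¹ i l • ((I * a l).trace • a i)) * I -
            I * ∑ i, ∑ l, G⁻¹ i l • ((I * a l).trace • a i) := by
        simp only [Finset.sum_mul, Finset.mul_sum, ← Finset.sum_sub_distrib, Matrix.smul_mul,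
          Matrix.mul_smul, ← smul_sub]
      rw [this, e2, Matrix.smul_mul, c, Matrix.mul_smul, sub_self]
  obtain ⟨u1, u2⟩ := main h
  obtain ⟨v1, v2⟩ := main h.rotate
  obtain ⟨w1, w2⟩ := main h.rotate.rotate
  clear_value a
  set I := u * G⁻¹
  set J := v * G⁻¹
  set K := w * G⁻¹
  have e (i l : Fin 8) : G⁻¹ i l • (a i * quatProj I J K (a l) - quatProj I J K (a l) * a i) =
      (3 / 4 : ℝ) • (G⁻¹ i l • (a i * a l - a l * a i)) +
      (1 / 4 : ℝ) • (G⁻¹ i l • (a i * (I * a l * I) - I * a l * I * a i) +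
        G⁻¹ i l • (a i * (J * a l * J) - J * a l * J * a i) +
        G⁻¹ i l • (a i * (K * a l * K) - K * a l * K * a i)) +
      (1 / 8 : ℝ) • (G⁻¹ i l • ((I * a l).trace • (a i * I - I * a i)) +
        G⁻¹ i l • ((J * a l).trace • (a i * J - J * a i)) +
        G⁻¹ i l • ((K * a l).trace • (a i * K - K * a i))) := by
    simp only [quatProj, mul_add, add_mul, Matrix.smul_mul, Matrix.mul_smul]
    module
  simp only [e, Finset.sum_add_distrib, ← Finset.smul_sum, h0, u1, u2, v1, v2, w1, w2]
  simp

end Casimir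
-- The model form in an arbitrary basis, and uniqueness of the torsion
/-- The Gram matrix of `ω₁`. -/
def omegaMat1 : Matrix (Fin 8) (Fin 8) ℤ :=
  !![0, 1, 0, 0, 0, 0, 0, 0; -1, 0, 0, 0, 0, 0, 0, 0; 0, 0, 0, 1, 0, 0, 0, 0;
    0, 0, -1, 0, 0, 0, 0, 0; 0, 0, 0, 0, 0, 1, 0, 0; 0, 0, 0, 0, -1, 0, 0, 0;
    0, 0, 0, 0, 0, 0, 0, 1; 0, 0, 0, 0, 0, 0, -1, 0]

/-- The Gram matrix of `ω₂`. -/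
def omegaMat2 : Matrix (Fin 8) (Fin 8) ℤ :=
  !![0, 0, 1, 0, 0, 0, 0, 0; 0, 0, 0, -1, 0, 0, 0, 0; -1, 0, 0, 0, 0, 0, 0, 0;
    0, 1, 0, 0, 0, 0, 0, 0; 0, 0, 0, 0, 0, 0, 1, 0; 0, 0, 0, 0, 0, 0, 0, -1;
    0, 0, 0, 0, -1, 0, 0, 0; 0, 0, 0, 0, 0, 1, 0, 0]

/-- The Gram matrix of `ω₃`. -/
def omegaMat3 : Matrix (Fin 8) (Fin 8) ℤ :=
  !![0, 0, 0, 1, 0, 0, 0, 0; 0, 0, 1, 0, 0, 0, 0, 0; 0, -1, 0, 0, 0, 0, 0, 0;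
    -1, 0, 0, 0, 0, 0, 0, 0; 0, 0, 0, 0, 0, 0, 0, 1; 0, 0, 0, 0, 0, 0, 1, 0;
    0, 0, 0, 0, 0, -1, 0, 0; 0, 0, 0, 0, -1, 0, 0, 0]

theorem omegaMat1_transpose : omegaMat1ᵀ = -omegaMat1 := by decide
theorem omegaMat2_transpose : omegaMat2ᵀ = -omegaMat2 := by decide
theorem omegaMat3_transpose : omegaMat3ᵀ = -omegaMat3 := by decide
theorem omegaMat1_sq : omegaMat1 * omegaMat1 = -1 := by decide +kernel
theorem omegaMat2_sq : omegaMat2 * omegaMat2 = -1 := by decide +kernel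
theorem omegaMat2_mul : omegaMat2 * omegaMat1 = omegaMat3 := by decide +kernel

/-- The matrix of the pull-back of a bilinear form on `ℝ⁸`. -/
def pullback (R : Matrix (Fin 8) (Fin 8) ℝ) (N : Matrix (Fin 8) (Fin 8) ℤ) :
    Matrix (Fin 8) (Fin 8) ℝ :=
  R * N.map (Int.cast : ℤ → ℝ) * Rᵀ

theorem pullback_omegaMat1 (x : Fin 8 → E8) (i j : Fin 8) :
    pullback (Matrix.of fun i a => x i a) omegaMat1 i j = omega1 (x i) (x j) := by
  simp [pullback, Matrix.mul_apply, Fin.sum_univ_eight, omegaMat1, omega1, dx]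
  ring

theorem pullback_omegaMat2 (x : Fin 8 → E8) (i j : Fin 8) :
    pullback (Matrix.of fun i a => x i a) omegaMat2 i j = omega2 (x i) (x j) := by
  simp [pullback, Matrix.mul_apply, Fin.sum_univ_eight, omegaMat2, omega2, dx]
  ring

theorem pullback_omegaMat3 (x : Fin 8 → E8) (i j : Fin 8) :
    pullback (Matrix.of fun i a => x i a) omegaMat3 i j = omega3 (x i) (x j) := by
  simp [pullback, Matrix.mul_apply, Fin.sum_univ_eight, omegaMat3, omega3, dx]
  ring

theorem pullback_transpose {R : Matrix (Fin 8) (Fin 8) ℝ} {N : Matrix (Fin 8) (Fin 8) ℤ}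
    (h : Nᵀ = -N) : (pullback R N)ᵀ = -pullback R N := by
  have h2 : (N.map (Int.cast : ℤ → ℝ))ᵀ = -N.map (Int.cast : ℤ → ℝ) := by
    rw [← Matrix.transpose_map, h]
    ext i j
    simp
  rw [pullback, Matrix.transpose_mul, Matrix.transpose_mul, h2, Matrix.transpose_transpose]
  noncomm_ring

/-- Raising an index turns the pull-back R N Rᵀ into the conjugate R N R⁻¹, which is multiplicative
in N. -/
theorem pullback_mul {R : Matrix (Fin 8) (Fin 8) ℝ} (hR : IsUnit R.det)
    {N P Q : Matrix (Fin 8) (Fin 8) ℤ} (h : N * P = Q) :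
    pullback R N * (R * Rᵀ)⁻¹ * (pullback R P * (R * Rᵀ)⁻¹) = pullback R Q * (R * Rᵀ)⁻¹ := by
  have e (N : Matrix (Fin 8) (Fin 8) ℤ) :
      pullback R N * (R * Rᵀ)⁻¹ = R * N.map (Int.cast : ℤ → ℝ) * R⁻¹ := by
    have ht : Rᵀ * Rᵀ⁻¹ = 1 := Matrix.mul_nonsing_inv _ (by rwa [Matrix.det_transpose])
    rw [pullback, Matrix.mul_inv_rev, mul_assoc, ← mul_assoc Rᵀ, ht, one_mul]
  have hm : Q.map (Int.cast : ℤ → ℝ) = N.map (Int.cast : ℤ → ℝ) * P.map (Int.cast : ℤ → ℝ) := by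
    rw [← h]; exact Matrix.map_mul (f := Int.castRingHom ℝ)
  rw [e, e, e, hm]
  have hi : R⁻¹ * R = 1 := Matrix.nonsing_inv_mul _ hR
  simp only [mul_assoc, mul_mul_eq_of_mul_eq hi, one_mul]

theorem pullback_neg_one {R : Matrix (Fin 8) (Fin 8) ℝ} (hR : IsUnit R.det) :
    pullback R (-1) * (R * Rᵀ)⁻¹ = -1 := by
  have h : (-1 : Matrix (Fin 8) (Fin 8) ℤ).map (Int.cast : ℤ → ℝ) = -1 := by
    ext i j; simp [Matrix.one_apply]
  have hu : IsUnit (R * Rᵀ).det := by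
    rw [Matrix.det_mul, Matrix.det_transpose]; exact hR.mul hR
  rw [pullback, h, mul_neg, mul_one, neg_mul, neg_mul, Matrix.mul_nonsing_inv _ hu]

/-- In any basis, an adapted pair is given by a quaternionic triple. -/
theorem IsAdapted.exists_quaternionic {V : Type*} [AddCommGroup V] [Module ℝ V]
    [TopologicalSpace V] {g : V →L[ℝ] V →L[ℝ] ℝ} {Ω : V [⋀^Fin 4]→L[ℝ] ℝ} (h : IsAdapted g Ω)
    {b : Fin 8 → V} (hb : LinearIndependent ℝ b) :
    ∃ R u v w : Matrix (Fin 8) (Fin 8) ℝ, IsUnit R.det ∧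
      (Matrix.of fun i j => g (b i) (b j)) = R * Rᵀ ∧
      IsQuaternionic (Matrix.of fun i j => g (b i) (b j))
        (fun i j k l => Ω ![b i, b j, b k, b l]) u v w := by
  obtain ⟨L, hg, hΩ⟩ := h
  set R : Matrix (Fin 8) (Fin 8) ℝ := Matrix.of fun i a => L (b i) a with hRdef
  have hG : (Matrix.of fun i j => g (b i) (b j)) = R * Rᵀ := by
    ext i j
    simp [hg, PiLp.inner_apply, Matrix.mul_apply, hRdef, mul_comm]
  have hR : IsUnit R.det := by
    rw [← Matrix.isUnit_iff_isUnit_det, ← Matrix.linearIndependent_rows_iff_isUnit]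
    have h1 : LinearIndependent ℝ fun i =>
        (L.trans (WithLp.linearEquiv 2 ℝ (Fin 8 → ℝ))) (b i) :=
      hb.map' (L.trans (WithLp.linearEquiv 2 ℝ (Fin 8 → ℝ))).toLinearMap
        (LinearEquiv.ker _)
    exact h1
  -- The first two forms are swapped, since the matrices of these forms satisfy ω₂ω₁ = ω₃ whereas
  -- ω₁ω₂ = -ω₃.
  refine ⟨R, pullback R omegaMat2, pullback R omegaMat1, pullback R omegaMat3, hR, hG, ?_⟩
  rw [hG]
  refine ⟨by simp, ?_, pullback_transpose omegaMat2_transpose,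
    pullback_transpose omegaMat1_transpose, pullback_transpose omegaMat3_transpose, ?_, ?_,
    pullback_mul hR omegaMat2_mul, ?_⟩
  · rw [Matrix.det_mul, Matrix.det_transpose]; exact hR.mul hR
  · rw [pullback_mul hR omegaMat2_sq, pullback_neg_one hR]
  · rw [pullback_mul hR omegaMat1_sq, pullback_neg_one hR]
  · funext i j k l
    rw [hΩ, modelForm]
    simp only [wedge2, hRdef, pullback_omegaMat1 (fun i => L (b i)),
      pullback_omegaMat2 (fun i => L (b i)), pullback_omegaMat3 (fun i => L (b i)), halfSquare,
      Matrix.cons_val]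
    ring

/-- Definiteness of the inner product on 2-forms. -/
theorem eq_zero_of_inner2_eq_zero {R : Matrix (Fin 8) (Fin 8) ℝ} (hR : IsUnit R.det)
    {α : Fin 8 → Fin 8 → ℝ} (hα : ∀ i j, α j i = -α i j) (h : inner2 (R * Rᵀ) α α = 0) :
    α = 0 := by
  have hα' : (Matrix.of α)ᵀ = -Matrix.of α := by ext i j; exact hα i j
  have e := inner2_eq_trace (G := R * Rᵀ) (by rw [Matrix.transpose_nonsing_inv]; simp) hα'
    (α := Matrix.of α)
  simp only [Matrix.of_apply] at e
  change inner2 (R * Rᵀ) α α = _ at e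
  -- `X` holds the components of `α` in an orthonormal frame, and the inner product is half of
  -- tr(XᵀX).
  set X := R⁻¹ * Matrix.of α * R⁻¹ᵀ with hX
  have hXt : Xᴴ * X = -(R⁻¹ * (Matrix.of α * (R * Rᵀ)⁻¹ * Matrix.of α * R⁻¹ᵀ)) := by
    rw [Matrix.conjTranspose_eq_transpose_of_trivial, hX, Matrix.transpose_mul,
      Matrix.transpose_mul, hα', Matrix.mul_inv_rev, Matrix.transpose_transpose,
      Matrix.transpose_nonsing_inv]
    noncomm_ring
  have htr : (Xᴴ * X).trace = 0 := by
    rw [hXt, Matrix.trace_neg, Matrix.trace_mul_comm, mul_assoc, Matrix.transpose_nonsing_inv,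
      ← Matrix.mul_inv_rev, mul_assoc]
    rw [h] at e
    linarith
  have hX0 : X = 0 := Matrix.trace_conjTranspose_mul_self_eq_zero_iff.mp htr
  have : Matrix.of α = R * X * Rᵀ := by
    rw [hX, Matrix.transpose_nonsing_inv]
    have h1 : R * R⁻¹ = 1 := Matrix.mul_nonsing_inv _ hR
    have h2 : Rᵀ⁻¹ * Rᵀ = 1 := Matrix.nonsing_inv_mul _ (by rwa [Matrix.det_transpose])
    simp only [mul_assoc, h2, mul_mul_eq_of_mul_eq h1, one_mul, mul_one]
  rw [hX0, mul_zero, zero_mul] at this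
  funext i j
  exact congrFun (congrFun this i) j

/-- Uniqueness of the intrinsic torsion. -/
theorem IsIntrinsicTorsionAt.unique {G : E8 → Matrix (Fin 8) (Fin 8) ℝ}
    {W : E8 → Fin 8 → Fin 8 → Fin 8 → Fin 8 → ℝ} {y : E8} {s t : Fin 8 → Fin 8 → Fin 8 → ℝ}
    {R : Matrix (Fin 8) (Fin 8) ℝ} (hR : IsUnit R.det) (hG : G y = R * Rᵀ)
    (hs : IsIntrinsicTorsionAt G W y s) (ht : IsIntrinsicTorsionAt G W y t) : s = t := by
  have inner2_sub (A : Matrix (Fin 8) (Fin 8) ℝ) (α β γ : Fin 8 → Fin 8 → ℝ) :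
      inner2 A (fun i j => α i j - β i j) γ = inner2 A α γ - inner2 A β γ := by
    simp only [inner2, mul_sub, sub_mul, Finset.sum_sub_distrib]
  funext i
  -- The difference of two torsions lies both in the stabiliser algebra and in its orthogonal
  -- complement.
  have hd (k l m n : Fin 8) : diamond (G y) (fun a b => s i a b - t i a b) (W y) k l m n = 0 := by
    have h1 := (hs i).2 k l m n
    rw [(ht i).2] at h1
    have h2 : diamond (G y) (fun a b => s i a b - t i a b) (W y) k l m n =
        diamond (G y) (s i) (W y) k l m n - diamond (G y) (t i) (W y) k l m n := by
      rw [diamond_eq_actForm, diamond_eq_actForm, diamond_eq_actForm, ← actForm_sub, ← sub_mul]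
      rfl
    rw [h2, h1, sub_self]
  have hk (a b : Fin 8) : s i b a - t i b a = -(s i a b - t i a b) := by
    rw [(hs i).1.1 a b, (ht i).1.1 a b]; ring
  have h0 : inner2 (G y) (fun a b => s i a b - t i a b) (fun a b => s i a b - t i a b) = 0 := by
    rw [inner2_sub, (hs i).1.2 _ hk hd, (ht i).1.2 _ hk hd, sub_self]
  rw [hG] at h0
  have := eq_zero_of_inner2_eq_zero hR hk h0
  funext a b
  exact sub_eq_zero.mp (congrFun (congrFun this a) b)

/-! ### The projection to `Λ²₁₅` in terms of the 4-form -/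

/-- The operator on 2-tensors given by a 4-form. -/
def formOp (G : Matrix (Fin 8) (Fin 8) ℝ) (W : Fin 8 → Fin 8 → Fin 8 → Fin 8 → ℝ) :
    Matrix (Fin 8) (Fin 8) ℝ →ₗ[ℝ] Matrix (Fin 8) (Fin 8) ℝ where
  toFun β := (1 / 2 : ℝ) • contract2 (G⁻¹ * β * G⁻¹) W
  map_add' α β := by
    rw [← smul_add]
    congr 1
    ext k l
    simp only [contract2, Matrix.of_apply, Matrix.add_apply, mul_add, add_mul,
      Finset.sum_add_distrib]
  map_smul' c β := by
    ext k l
    simp only [contract2, Matrix.of_apply, Matrix.smul_apply, Matrix.mul_smul, Matrix.smul_mul,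
      smul_eq_mul, RingHom.id_apply, Finset.mul_sum]
    exact Finset.sum_congr rfl fun _ _ => Finset.sum_congr rfl fun _ _ => by ring

theorem formOp_apply (G : Matrix (Fin 8) (Fin 8) ℝ) (W : Fin 8 → Fin 8 → Fin 8 → Fin 8 → ℝ)
    (β : Matrix (Fin 8) (Fin 8) ℝ) :
    formOp G W β = (1 / 2 : ℝ) • contract2 (G⁻¹ * β * G⁻¹) W := rfl

/-- The polynomial in `formOp` that is the projection to `Λ²₁₅`. -/
def formProj (G : Matrix (Fin 8) (Fin 8) ℝ) (W : Fin 8 → Fin 8 → Fin 8 → Fin 8 → ℝ) :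
    Matrix (Fin 8) (Fin 8) ℝ →ₗ[ℝ] Matrix (Fin 8) (Fin 8) ℝ :=
  (15 / 16 : ℝ) • LinearMap.id + (1 / 8 : ℝ) • formOp G W -
    (1 / 16 : ℝ) • (formOp G W ∘ₗ formOp G W)

theorem formProj_apply (G : Matrix (Fin 8) (Fin 8) ℝ) (W : Fin 8 → Fin 8 → Fin 8 → Fin 8 → ℝ)
    (β : Matrix (Fin 8) (Fin 8) ℝ) : formProj G W β =
      (15 / 16 : ℝ) • β + (1 / 8 : ℝ) • formOp G W β -
        (1 / 16 : ℝ) • formOp G W (formOp G W β) := rfl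

section

variable {G u v w : Matrix (Fin 8) (Fin 8) ℝ} {W : Fin 8 → Fin 8 → Fin 8 → Fin 8 → ℝ}

theorem IsQuaternionic.formOp_eq (h : IsQuaternionic G W u v w)
    {β : Matrix (Fin 8) (Fin 8) ℝ} (hβ : βᵀ = -β) :
    formOp G W β = quatOp (u * G⁻¹) (v * G⁻¹) (w * G⁻¹) (β * G⁻¹) * G := by
  have hN : (G⁻¹ * β * G⁻¹)ᵀ = -(G⁻¹ * β * G⁻¹) := by
    simp only [Matrix.transpose_mul, h.inv_symm, hβ]; noncomm_ring
  have e (X : Matrix (Fin 8) (Fin 8) ℝ) : X * G⁻¹ * G = X := by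
    rw [mul_assoc, Matrix.nonsing_inv_mul _ h.isUnit, mul_one]
  have e2 : G⁻¹ * G = 1 := Matrix.nonsing_inv_mul _ h.isUnit
  have hc (X : Matrix (Fin 8) (Fin 8) ℝ) (hX : Xᵀ = -X) :
      contract2 (G⁻¹ * β * G⁻¹) (fun k l m n => wedge2 X X k l m n) =
        (2 : ℝ) • (X * G⁻¹ * (β * G⁻¹) * (X * G⁻¹) * G) -
          (X * G⁻¹ * (β * G⁻¹)).trace • (X * G⁻¹ * G) := by
    rw [e]
    change contract2 (G⁻¹ * β * G⁻¹) (wedge2 X X) = _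
    rw [contract2_wedge2 hN hX]
    simp only [mul_assoc, e2, mul_one]
  rw [formOp_apply]
  conv_lhs => rw [h.form]
  rw [contract2_add, contract2_add, hc u h.skew₁, hc v h.skew₂, hc w h.skew₃, quatOp]
  simp only [sub_mul, add_mul, Matrix.smul_mul]
  module

theorem IsQuaternionic.formOp_skew (h : IsQuaternionic G W u v w)
    {β : Matrix (Fin 8) (Fin 8) ℝ} (hβ : βᵀ = -β) : (formOp G W β)ᵀ = -formOp G W β := by
  have e (X : Matrix (Fin 8) (Fin 8) ℝ) : X * G⁻¹ * G = X := by
    rw [mul_assoc, Matrix.nonsing_inv_mul _ h.isUnit, mul_one]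
  have e2 : G⁻¹ * G = 1 := Matrix.nonsing_inv_mul _ h.isUnit
  rw [h.formOp_eq hβ, quatOp]
  simp only [add_mul, sub_mul, Matrix.smul_mul, mul_assoc, e2, mul_one, Matrix.transpose_add,
    Matrix.transpose_sub, Matrix.transpose_smul, Matrix.transpose_mul, h.skew₁, h.skew₂,
    h.skew₃, hβ, h.inv_symm, neg_mul, mul_neg]
  module

/-- `formOp` corresponds to `quatOp` on skew matrices and preserves skewness, so polynomials in the
two also correspond. -/
theorem IsQuaternionic.formProj_eq (h : IsQuaternionic G W u v w)
    {β : Matrix (Fin 8) (Fin 8) ℝ} (hβ : βᵀ = -β) :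
    formProj G W β = quatProj (u * G⁻¹) (v * G⁻¹) (w * G⁻¹) (β * G⁻¹) * G := by
  have e (X : Matrix (Fin 8) (Fin 8) ℝ) : X * G * G⁻¹ = X := by
    rw [mul_assoc, Matrix.mul_nonsing_inv _ h.isUnit, mul_one]
  have e2 (X : Matrix (Fin 8) (Fin 8) ℝ) : X * G⁻¹ * G = X := by
    rw [mul_assoc, Matrix.nonsing_inv_mul _ h.isUnit, mul_one]
  rw [← h.triple.quatProj_eq_quatOp, formProj_apply, h.formOp_eq (h.formOp_skew hβ),
    h.formOp_eq hβ, e]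
  simp only [sub_mul, add_mul, Matrix.smul_mul, e2]

/-- The infinitesimal invariance of the contraction of a 4-form with a bivector. -/
theorem contract2_actForm (A N : Matrix (Fin 8) (Fin 8) ℝ) :
    contract2 N (fun k l m n => actForm A W k l m n) =
      A * contract2 N W + contract2 N W * Aᵀ + contract2 (Aᵀ * N + N * A) W := by
  ext k l
  have e1 : (A * contract2 N W) k l = ∑ m, ∑ n, ∑ q, A k q * W q l m n * N m n := by
    simp only [Matrix.mul_apply, contract2, Matrix.of_apply, Finset.mul_sum]
    rw [Finset.sum_comm]
    refine Finset.sum_congr rfl fun m _ => ?_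
    rw [Finset.sum_comm]
    exact Finset.sum_congr rfl fun n _ => Finset.sum_congr rfl fun q _ => by ring
  have e2 : (contract2 N W * Aᵀ) k l = ∑ m, ∑ n, ∑ q, A l q * W k q m n * N m n := by
    simp only [Matrix.mul_apply, contract2, Matrix.of_apply, Finset.sum_mul,
      Matrix.transpose_apply]
    rw [Finset.sum_comm]
    refine Finset.sum_congr rfl fun m _ => ?_
    rw [Finset.sum_comm]
    exact Finset.sum_congr rfl fun n _ => Finset.sum_congr rfl fun q _ => by ring
  have e3 : contract2 (Aᵀ * N) W k l = ∑ m, ∑ n, ∑ q, A m q * W k l q n * N m n := by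
    simp only [Matrix.mul_apply, contract2, Matrix.of_apply, Finset.mul_sum,
      Matrix.transpose_apply]
    rw [Finset.sum_comm]
    conv_rhs => rw [Finset.sum_comm]
    refine Finset.sum_congr rfl fun n _ => ?_
    rw [Finset.sum_comm]
    exact Finset.sum_congr rfl fun m _ => Finset.sum_congr rfl fun q _ => by ring
  have e4 : contract2 (N * A) W k l = ∑ m, ∑ n, ∑ q, A n q * W k l m q * N m n := by
    simp only [Matrix.mul_apply, contract2, Matrix.of_apply, Finset.mul_sum]
    refine Finset.sum_congr rfl fun m _ => ?_
    rw [Finset.sum_comm]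
    exact Finset.sum_congr rfl fun n _ => Finset.sum_congr rfl fun q _ => by ring
  have e5 : contract2 (Aᵀ * N + N * A) W k l =
      contract2 (Aᵀ * N) W k l + contract2 (N * A) W k l := by
    simp only [contract2, Matrix.of_apply, Matrix.add_apply, mul_add, Finset.sum_add_distrib]
  rw [Matrix.add_apply, Matrix.add_apply, e5, e1, e2, e3, e4]
  simp only [contract2, Matrix.of_apply, actForm, Finset.sum_mul, add_mul,
    Finset.sum_add_distrib]
  ring

end

/-! ### Partial derivatives of matrix-valued functions -/

theorem pderiv_congr {φ ψ : E8 → ℝ} {y : E8} (h : φ =ᶠ[nhds y] ψ) (i : Fin 8) :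
    pderiv i φ y = pderiv i ψ y := by
  rw [pderiv, pderiv, h.fderiv_eq]

section Calculus

variable {φ ψ : E8 → ℝ} {y : E8} (i : Fin 8)

theorem pderiv_const (c : ℝ) : pderiv i (fun _ => c) y = 0 := by simp [pderiv]

theorem pderiv_add (hφ : DifferentiableAt ℝ φ y) (hψ : DifferentiableAt ℝ ψ y) :
    pderiv i (fun z => φ z + ψ z) y = pderiv i φ y + pderiv i ψ y := by
  simp [pderiv, fderiv_fun_add hφ hψ]

theorem pderiv_sub (hφ : DifferentiableAt ℝ φ y) (hψ : DifferentiableAt ℝ ψ y) :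
    pderiv i (fun z => φ z - ψ z) y = pderiv i φ y - pderiv i ψ y := by
  simp [pderiv, fderiv_fun_sub hφ hψ]

theorem pderiv_mul (hφ : DifferentiableAt ℝ φ y) (hψ : DifferentiableAt ℝ ψ y) :
    pderiv i (fun z => φ z * ψ z) y = pderiv i φ y * ψ y + φ y * pderiv i ψ y := by
  simp [pderiv, fderiv_fun_mul hφ hψ]
  ring

theorem pderiv_const_mul (c : ℝ) (hφ : DifferentiableAt ℝ φ y) :
    pderiv i (fun z => c * φ z) y = c * pderiv i φ y := by
  rw [pderiv_mul i (differentiableAt_const c) hφ, pderiv_const]; ring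

theorem pderiv_sum {ι : Type*} (s : Finset ι) {φ : ι → E8 → ℝ}
    (hφ : ∀ j ∈ s, DifferentiableAt ℝ (φ j) y) :
    pderiv i (fun z => ∑ j ∈ s, φ j z) y = ∑ j ∈ s, pderiv i (φ j) y := by
  simp [pderiv, fderiv_fun_sum hφ]

theorem pderiv_exp_mul (c : ℝ) (hφ : DifferentiableAt ℝ φ y) (hψ : DifferentiableAt ℝ ψ y) :
    pderiv i (fun z => Real.exp (c * φ z) * ψ z) y =
      Real.exp (c * φ y) * (pderiv i ψ y + c * pderiv i φ y * ψ y) := by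
  have h : DifferentiableAt ℝ (fun z => c * φ z) y := hφ.const_mul c
  have he : pderiv i (fun z => Real.exp (c * φ z)) y =
      Real.exp (c * φ y) * (c * pderiv i φ y) := by
    rw [← pderiv_const_mul i c hφ]
    simp [pderiv, fderiv_exp h]
  rw [pderiv_mul i h.exp hψ, he]
  ring

end Calculus

/-- Entrywise partial derivative of a matrix-valued function. -/
def pderivMat (i : Fin 8) (F : E8 → Matrix (Fin 8) (Fin 8) ℝ) (y : E8) :
    Matrix (Fin 8) (Fin 8) ℝ :=
  Matrix.of fun a b => pderiv i (fun z => F z a b) y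

/-- Entrywise differentiability of a matrix-valued function. -/
def EntryDiffAt (F : E8 → Matrix (Fin 8) (Fin 8) ℝ) (y : E8) : Prop :=
  ∀ a b, DifferentiableAt ℝ (fun z => F z a b) y

section MatCalculus

variable {F H : E8 → Matrix (Fin 8) (Fin 8) ℝ} {y : E8}

theorem EntryDiffAt.mul (hF : EntryDiffAt F y) (hH : EntryDiffAt H y) :
    EntryDiffAt (fun z => F z * H z) y := fun a b => by
  simp only [Matrix.mul_apply]
  exact DifferentiableAt.fun_sum fun c _ => (hF a c).mul (hH c b)

theorem EntryDiffAt.smul (c : ℝ) (hF : EntryDiffAt F y) :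
    EntryDiffAt (fun z => c • F z) y := fun a b => by
  simp only [Matrix.smul_apply, smul_eq_mul]
  exact (hF a b).const_mul c

theorem EntryDiffAt.add (hF : EntryDiffAt F y) (hH : EntryDiffAt H y) :
    EntryDiffAt (fun z => F z + H z) y := fun a b => by
  simp only [Matrix.add_apply]
  exact (hF a b).add (hH a b)

theorem pderivMat_mul (hF : EntryDiffAt F y) (hH : EntryDiffAt H y) (i : Fin 8) :
    pderivMat i (fun z => F z * H z) y = pderivMat i F y * H y + F y * pderivMat i H y := by
  ext a b
  simp only [pderivMat, Matrix.of_apply, Matrix.mul_apply, Matrix.add_apply]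
  rw [← Finset.sum_add_distrib]
  refine (pderiv_sum i Finset.univ (φ := fun c z => F z a c * H z c b)
    fun c _ => (hF a c).mul (hH c b)).trans ?_
  exact Finset.sum_congr rfl fun c _ => pderiv_mul i (hF a c) (hH c b)

theorem pderivMat_add (hF : EntryDiffAt F y) (hH : EntryDiffAt H y) (i : Fin 8) :
    pderivMat i (fun z => F z + H z) y = pderivMat i F y + pderivMat i H y := by
  ext a b
  exact pderiv_add i (hF a b) (hH a b)

theorem pderivMat_sub (hF : EntryDiffAt F y) (hH : EntryDiffAt H y) (i : Fin 8) :
    pderivMat i (fun z => F z - H z) y = pderivMat i F y - pderivMat i H y := by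
  ext a b
  exact pderiv_sub i (hF a b) (hH a b)

theorem pderivMat_smul (c : ℝ) (hF : EntryDiffAt F y) (i : Fin 8) :
    pderivMat i (fun z => c • F z) y = c • pderivMat i F y := by
  ext a b
  exact pderiv_const_mul i c (hF a b)

/-- Cramer's rule writes each entry of the inverse as a quotient of determinants. -/
theorem contDiffAt_inv_apply {n : WithTop ℕ∞} (hF : ∀ a b, ContDiffAt ℝ n (fun z => F z a b) y)
    (hu : IsUnit (F y).det) (a b : Fin 8) : ContDiffAt ℝ n (fun z => (F z)⁻¹ a b) y := by
  have hdet (F : E8 → Matrix (Fin 8) (Fin 8) ℝ)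
      (hF : ∀ a b, ContDiffAt ℝ n (fun z => F z a b) y) :
      ContDiffAt ℝ n (fun z => (F z).det) y := by
    simp only [Matrix.det_apply']
    exact ContDiffAt.sum fun σ _ => contDiffAt_const.mul (contDiffAt_prod fun c _ => hF _ _)
  have h : (fun z => (F z)⁻¹ a b) =
      fun z => (F z).det⁻¹ * ((F z).updateRow b (Pi.single a 1)).det := by
    funext z
    rw [Matrix.inv_def, Matrix.smul_apply, Matrix.adjugate_apply, Ring.inverse_eq_inv',
      smul_eq_mul]
  rw [h]
  refine ((hdet F hF).inv hu.ne_zero).mul (hdet _ fun c d => ?_)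
  simp only [Matrix.updateRow_apply]
  split_ifs
  · exact contDiffAt_const
  · exact hF c d

theorem pderivMat_inv (hF : ∀ a b, ContDiffAt ℝ ∞ (fun z => F z a b) y)
    (hu : ∀ᶠ z in nhds y, IsUnit (F z).det) (i : Fin 8) :
    pderivMat i (fun z => (F z)⁻¹) y = -((F y)⁻¹ * pderivMat i F y * (F y)⁻¹) := by
  have hd : EntryDiffAt F y := fun a b => (hF a b).differentiableAt (by simp)
  have hi : EntryDiffAt (fun z => (F z)⁻¹) y := fun a b =>
    (contDiffAt_inv_apply hF hu.self_of_nhds a b).differentiableAt (by simp)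
  have h1 : pderivMat i (fun z => F z * (F z)⁻¹) y = 0 := by
    ext a b
    simp only [pderivMat, Matrix.of_apply, Matrix.zero_apply]
    rw [← pderiv_const i ((1 : Matrix (Fin 8) (Fin 8) ℝ) a b) (y := y)]
    refine pderiv_congr ?_ i
    filter_upwards [hu] with z hz
    rw [Matrix.mul_nonsing_inv _ hz]
  rw [pderivMat_mul hd hi] at h1
  have h2 := congrArg ((F y)⁻¹ * ·) h1
  simp only [mul_add, mul_zero, ← mul_assoc, Matrix.nonsing_inv_mul _ hu.self_of_nhds,
    one_mul] at h2
  rw [← sub_eq_zero, sub_neg_eq_add, ← h2]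
  abel

end MatCalculus
-- The Levi-Civita connection, conformal change and parallel operators
/-- The connection matrix of the Levi-Civita connection in the direction `∂_i`. -/
def connMat (G : E8 → Matrix (Fin 8) (Fin 8) ℝ) (y : E8) (i : Fin 8) :
    Matrix (Fin 8) (Fin 8) ℝ :=
  Matrix.of fun k p => christoffel G y p i k

theorem nablaForm_eq (G : E8 → Matrix (Fin 8) (Fin 8) ℝ)
    (W : E8 → Fin 8 → Fin 8 → Fin 8 → Fin 8 → ℝ) (y : E8) (i k l m n : Fin 8) :
    nablaForm G W y i k l m n =
      pderiv i (fun z => W z k l m n) y - actForm (connMat G y i) (W y) k l m n := rfl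

/-- The gradient covector of a function. -/
def gradVec (f : E8 → ℝ) (z : E8) (i : Fin 8) : ℝ := pderiv i f z

section

variable {G : E8 → Matrix (Fin 8) (Fin 8) ℝ} {W : E8 → Fin 8 → Fin 8 → Fin 8 → Fin 8 → ℝ}
  {f : E8 → ℝ} {y : E8}

theorem christoffel_symm (hs : ∀ᶠ z in nhds y, (G z)ᵀ = G z) (k i j : Fin 8) :
    christoffel G y k i j = christoffel G y k j i := by
  have h (l : Fin 8) : pderiv l (fun z => G z i j) y = pderiv l (fun z => G z j i) y := by
    refine pderiv_congr ?_ l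
    filter_upwards [hs] with z hz
    exact congrFun (congrFun hz j) i
  unfold christoffel
  congr 1
  refine Finset.sum_congr rfl fun l _ => ?_
  rw [h]
  ring

theorem sum_christoffel_mul (hs : (G y)ᵀ = G y) (hu : IsUnit (G y).det) (i j k : Fin 8) :
    ∑ p, christoffel G y p i j * G y p k =
      (1 / 2) * (pderiv i (fun z => G z j k) y + pderiv j (fun z => G z i k) y -
        pderiv k (fun z => G z i j) y) := by
  set c : Fin 8 → ℝ := fun l => pderiv i (fun z => G z j l) y + pderiv j (fun z => G z i l) y -
    pderiv l (fun z => G z i j) y with hc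
  have h1 (l : Fin 8) : ∑ p, (G y)⁻¹ p l * G y p k = if l = k then 1 else 0 := by
    have h2 : (G y)⁻¹ᵀ * G y = 1 := by
      rw [Matrix.transpose_nonsing_inv, hs, Matrix.nonsing_inv_mul _ hu]
    have := congrFun (congrFun h2 l) k
    rw [Matrix.mul_apply, Matrix.one_apply] at this
    exact this
  have h3 : ∑ p, christoffel G y p i j * G y p k =
      (1 / 2) * ∑ l, c l * ∑ p, (G y)⁻¹ p l * G y p k := by
    simp only [christoffel, Finset.mul_sum, Finset.sum_mul]
    rw [Finset.sum_comm]
    exact Finset.sum_congr rfl fun l _ => Finset.sum_congr rfl fun p _ => by ring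
  rw [h3]
  simp only [h1, mul_ite, mul_one, mul_zero, Finset.sum_ite_eq', Finset.mem_univ, if_true, hc]

/-- The Levi-Civita connection is metric. -/
theorem pderivMat_metric (hs : ∀ᶠ z in nhds y, (G z)ᵀ = G z) (hu : IsUnit (G y).det)
    (i : Fin 8) :
    pderivMat i G y = connMat G y i * G y + G y * (connMat G y i)ᵀ := by
  have h (l a b : Fin 8) : pderiv l (fun z => G z a b) y = pderiv l (fun z => G z b a) y := by
    refine pderiv_congr ?_ l
    filter_upwards [hs] with z hz
    exact congrFun (congrFun hz b) a
  have hs0 := hs.self_of_nhds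
  ext j k
  have e1 : (connMat G y i * G y) j k = ∑ p, christoffel G y p i j * G y p k := rfl
  have e2 : (G y * (connMat G y i)ᵀ) j k = ∑ p, christoffel G y p i k * G y p j := by
    rw [Matrix.mul_apply]
    refine Finset.sum_congr rfl fun p _ => ?_
    have : G y j p = G y p j := congrFun (congrFun hs0 p) j
    rw [this, mul_comm]
    rfl
  rw [Matrix.add_apply, e1, e2, sum_christoffel_mul hs0 hu, sum_christoffel_mul hs0 hu]
  change pderiv i (fun z => G z j k) y = _
  rw [h i k j, h k i j, h j i k]
  ring

/-- The connection matrices of a conformal metric. -/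
theorem connMat_conformal (hG : EntryDiffAt G y) (hs : (G y)ᵀ = G y) (hu : IsUnit (G y).det)
    (hf : DifferentiableAt ℝ f y) (i : Fin 8) :
    connMat (fun z => Real.exp (-2 * f z) • G z) y i =
      connMat G y i - gradVec f y i • 1 + flatWedge (G y) (gradVec f y) i * (G y)⁻¹ := by
  have hi : (Real.exp (-2 * f y) • G y)⁻¹ = (Real.exp (2 * f y)) • (G y)⁻¹ := by
    refine Matrix.inv_eq_right_inv ?_
    rw [Matrix.smul_mul, Matrix.mul_smul, smul_smul, ← Real.exp_add, Matrix.mul_nonsing_inv _ hu]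
    simp
  have h1 (p l : Fin 8) : ∑ q, (G y)⁻¹ p q * G y l q = if p = l then 1 else 0 := by
    have h2 : (G y)⁻¹ * (G y)ᵀ = 1 := by rw [hs, Matrix.nonsing_inv_mul _ hu]
    have := congrFun (congrFun h2 p) l
    rw [Matrix.mul_apply, Matrix.one_apply] at this
    exact this
  have hd (a b c : Fin 8) : pderiv a (fun z => Real.exp (-2 * f z) * G z b c) y =
      Real.exp (-2 * f y) * (pderiv a (fun z => G z b c) y + -2 * gradVec f y a * G y b c) :=
    pderiv_exp_mul a (-2) hf (hG b c)
  have he : Real.exp (2 * f y) * Real.exp (-2 * f y) = 1 := by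
    rw [← Real.exp_add]; simp
  have hinv (p q : Fin 8) : (G y)⁻¹ p q = (G y)⁻¹ q p := by
    have : (G y)⁻¹ᵀ = (G y)⁻¹ := by rw [Matrix.transpose_nonsing_inv, hs]
    exact congrFun (congrFun this q) p
  ext k p
  rw [flatWedge_mul_inv hu]
  simp only [connMat, Matrix.of_apply, Matrix.add_apply, Matrix.sub_apply, Matrix.smul_apply,
    Matrix.one_apply, Matrix.vecMulVec_apply, Matrix.row_apply, smul_eq_mul, Pi.single_apply]
  have e1 : christoffel (fun z => Real.exp (-2 * f z) • G z) y p i k =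
      christoffel G y p i k - gradVec f y i * ∑ q, (G y)⁻¹ p q * G y k q -
        gradVec f y k * ∑ q, (G y)⁻¹ p q * G y i q +
        G y i k * ∑ q, (G y)⁻¹ p q * gradVec f y q := by
    simp only [christoffel, hi, hd, Finset.mul_sum, ← Finset.sum_sub_distrib,
      ← Finset.sum_add_distrib, Matrix.smul_apply, smul_eq_mul]
    refine Finset.sum_congr rfl fun q _ => ?_
    linear_combination ((1 / 2) * (G y)⁻¹ p q *
      (pderiv i (fun z => G z k q) y + pderiv k (fun z => G z i q) y
        - pderiv q (fun z => G z i k) y - 2 * gradVec f y i * G y k q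
        - 2 * gradVec f y k * G y i q + 2 * gradVec f y q * G y i k)) * he
  have e2 : ∑ q, (G y)⁻¹ p q * gradVec f y q = (gradVec f y ᵥ* (G y)⁻¹) p := by
    rw [Matrix.vecMul, dotProduct]
    exact Finset.sum_congr rfl fun q _ => by rw [hinv p q, mul_comm]
  rw [e1, h1, h1, e2]
  simp only [eq_comm (a := p)]
  ring

/-- If a conformal change of the 4-form is parallel, then the 4-form is parallel for the metric
connection with torsion given by the gradient. -/
theorem pderiv_form_of_nablaForm_eq_zero (hG : EntryDiffAt G y) (hs : (G y)ᵀ = G y)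
    (hu : IsUnit (G y).det) (hf : DifferentiableAt ℝ f y)
    (hW : ∀ k l m n, DifferentiableAt ℝ (fun z => W z k l m n) y) (i : Fin 8)
    (h : ∀ k l m n, nablaForm (fun z => Real.exp (-2 * f z) • G z)
      (fun z k l m n => Real.exp (-4 * f z) * W z k l m n) y i k l m n = 0) (k l m n : Fin 8) :
    pderiv i (fun z => W z k l m n) y =
      actForm (connMat G y i + flatWedge (G y) (gradVec f y) i * (G y)⁻¹) (W y) k l m n := by
  have h1 := h k l m n
  rw [nablaForm_eq, connMat_conformal hG hs hu hf, pderiv_exp_mul i (-4) hf (hW k l m n),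
    actForm_smul_form, ← mul_sub] at h1
  have h2 := (mul_eq_zero.mp h1).resolve_left (Real.exp_ne_zero _)
  -- On a 4-form the scalar part of the connection matrix acts as -4 times the gradient component,
  -- matching the derivative of e^{-4f}.
  rw [actForm_add, actForm_sub, actForm_smul, actForm_one] at h2
  rw [actForm_add]
  change pderiv i (fun z => W z k l m n) y + -4 * gradVec f y i * W y k l m n - _ = 0 at h2
  linarith

/-- `formOp` commutes with metric connections that preserve the 4-form. -/
theorem pderivMat_formOp {A : Matrix (Fin 8) (Fin 8) ℝ} (i : Fin 8)
    (hG : ∀ a b, ContDiffAt ℝ ∞ (fun z => G z a b) y)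
    (hu : ∀ᶠ z in nhds y, IsUnit (G z).det)
    (hW : ∀ k l m n, DifferentiableAt ℝ (fun z => W z k l m n) y)
    (hGA : pderivMat i G y = A * G y + G y * Aᵀ)
    (hWA : ∀ k l m n, pderiv i (fun z => W z k l m n) y = actForm A (W y) k l m n)
    {β : E8 → Matrix (Fin 8) (Fin 8) ℝ} (hβ : EntryDiffAt β y) :
    EntryDiffAt (fun z => formOp (G z) (W z) (β z)) y ∧
    pderivMat i (fun z => formOp (G z) (W z) (β z)) y -
        (A * formOp (G y) (W y) (β y) + formOp (G y) (W y) (β y) * Aᵀ) =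
      formOp (G y) (W y) (pderivMat i β y - (A * β y + β y * Aᵀ)) := by
  have hi : EntryDiffAt (fun z => (G z)⁻¹) y := fun a b =>
    (contDiffAt_inv_apply hG hu.self_of_nhds a b).differentiableAt (by simp)
  have hN : EntryDiffAt (fun z => (G z)⁻¹ * β z * (G z)⁻¹) y := (hi.mul hβ).mul hi
  have hWN (a b m n : Fin 8) : DifferentiableAt ℝ
      (fun z => W z a b m n * ((G z)⁻¹ * β z * (G z)⁻¹) m n) y := (hW a b m n).mul (hN m n)
  -- A connection preserving the metric also preserves the inverse metric.
  have hdi : pderivMat i (fun z => (G z)⁻¹) y = -((G y)⁻¹ * A + Aᵀ * (G y)⁻¹) := by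
    have e1 := Matrix.nonsing_inv_mul _ hu.self_of_nhds
    have e2 := Matrix.mul_nonsing_inv _ hu.self_of_nhds
    rw [pderivMat_inv hG hu, hGA, mul_add, add_mul, ← mul_assoc _ (G y), e1, one_mul,
      mul_assoc, mul_assoc, e2, mul_one, add_comm]
  have hdN : pderivMat i (fun z => (G z)⁻¹ * β z * (G z)⁻¹) y =
      (G y)⁻¹ * (pderivMat i β y - (A * β y + β y * Aᵀ)) * (G y)⁻¹ -
        (Aᵀ * ((G y)⁻¹ * β y * (G y)⁻¹) + (G y)⁻¹ * β y * (G y)⁻¹ * A) := by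
    rw [pderivMat_mul (hi.mul hβ) hi, pderivMat_mul hi hβ, hdi]
    noncomm_ring
  have hcd : EntryDiffAt (fun z => contract2 ((G z)⁻¹ * β z * (G z)⁻¹) (W z)) y := fun a b => by
    simp only [contract2, Matrix.of_apply]
    exact DifferentiableAt.fun_sum fun m _ => DifferentiableAt.fun_sum fun n _ => hWN a b m n
  have hdc : pderivMat i (fun z => contract2 ((G z)⁻¹ * β z * (G z)⁻¹) (W z)) y =
      contract2 ((G y)⁻¹ * β y * (G y)⁻¹) (fun k l m n => actForm A (W y) k l m n) +
        contract2 (pderivMat i (fun z => (G z)⁻¹ * β z * (G z)⁻¹) y) (W y) := by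
    ext a b
    refine (pderiv_sum i Finset.univ (φ := fun m z => ∑ n, W z a b m n *
      ((G z)⁻¹ * β z * (G z)⁻¹) m n) fun m _ => DifferentiableAt.fun_sum fun n _ =>
        hWN a b m n).trans ?_
    simp only [contract2, Matrix.add_apply, Matrix.of_apply, ← Finset.sum_add_distrib]
    refine Finset.sum_congr rfl fun m _ => ?_
    refine (pderiv_sum i Finset.univ (φ := fun n z => W z a b m n *
      ((G z)⁻¹ * β z * (G z)⁻¹) m n) fun n _ => hWN a b m n).trans ?_
    refine Finset.sum_congr rfl fun n _ => ?_
    rw [pderiv_mul i (hW a b m n) (hN m n), hWA]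
    rfl
  have hsub (X Y : Matrix (Fin 8) (Fin 8) ℝ) :
      contract2 (X - Y) (W y) = contract2 X (W y) - contract2 Y (W y) := by
    ext a b
    simp only [contract2, Matrix.of_apply, Matrix.sub_apply, mul_sub, Finset.sum_sub_distrib]
  refine ⟨hcd.smul _, ?_⟩
  simp only [formOp_apply]
  -- The action of `A` on the two contracted slots of the form cancels its action on the bivector.
  rw [pderivMat_smul _ hcd, hdc, contract2_actForm, hdN, hsub]
  simp only [Matrix.mul_smul, Matrix.smul_mul]
  module

/-- `formProj` commutes with metric connections that preserve the 4-form. -/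
theorem pderivMat_formProj {A : Matrix (Fin 8) (Fin 8) ℝ} (i : Fin 8)
    (hG : ∀ a b, ContDiffAt ℝ ∞ (fun z => G z a b) y)
    (hu : ∀ᶠ z in nhds y, IsUnit (G z).det)
    (hW : ∀ k l m n, DifferentiableAt ℝ (fun z => W z k l m n) y)
    (hGA : pderivMat i G y = A * G y + G y * Aᵀ)
    (hWA : ∀ k l m n, pderiv i (fun z => W z k l m n) y = actForm A (W y) k l m n)
    {β : E8 → Matrix (Fin 8) (Fin 8) ℝ} (hβ : EntryDiffAt β y) :
    pderivMat i (fun z => formProj (G z) (W z) (β z)) y -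
        (A * formProj (G y) (W y) (β y) + formProj (G y) (W y) (β y) * Aᵀ) =
      formProj (G y) (W y) (pderivMat i β y - (A * β y + β y * Aᵀ)) := by
  obtain ⟨d1, e1⟩ := pderivMat_formOp i hG hu hW hGA hWA hβ
  obtain ⟨d2, e2⟩ := pderivMat_formOp i hG hu hW hGA hWA d1
  simp only [formProj_apply]
  rw [pderivMat_sub ((hβ.smul _).add (d1.smul _)) (d2.smul _),
    pderivMat_add (hβ.smul _) (d1.smul _), pderivMat_smul _ hβ, pderivMat_smul _ d1,
    pderivMat_smul _ d2, ← e1, ← e2]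
  simp only [mul_add, add_mul, mul_sub, sub_mul, Matrix.mul_smul, Matrix.smul_mul]
  module

end

/-! ### The torsion of a conformally parallel structure and its divergence -/

section

variable {G : E8 → Matrix (Fin 8) (Fin 8) ℝ} {W : E8 → Fin 8 → Fin 8 → Fin 8 → Fin 8 → ℝ}
  {f : E8 → ℝ} {y : E8}

theorem contDiffAt_formOp {β : E8 → Matrix (Fin 8) (Fin 8) ℝ}
    (hG : ∀ a b, ContDiffAt ℝ ∞ (fun z => G z a b) y) (hu : IsUnit (G y).det)
    (hW : ∀ k l m n, ContDiffAt ℝ ∞ (fun z => W z k l m n) y)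
    (hβ : ∀ a b, ContDiffAt ℝ ∞ (fun z => β z a b) y) (a b : Fin 8) :
    ContDiffAt ℝ ∞ (fun z => formOp (G z) (W z) (β z) a b) y := by
  have hi := contDiffAt_inv_apply hG hu
  have hmul {F H : E8 → Matrix (Fin 8) (Fin 8) ℝ}
      (hF : ∀ a b, ContDiffAt ℝ ∞ (fun z => F z a b) y)
      (hH : ∀ a b, ContDiffAt ℝ ∞ (fun z => H z a b) y) (a b : Fin 8) :
      ContDiffAt ℝ ∞ (fun z => (F z * H z) a b) y := by
    simp only [Matrix.mul_apply]
    exact ContDiffAt.sum fun c _ => (hF a c).mul (hH c b)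
  have hN := hmul (hmul hi hβ) hi
  simp only [formOp_apply, Matrix.smul_apply, smul_eq_mul, contract2, Matrix.of_apply]
  exact contDiffAt_const.mul (ContDiffAt.sum fun m _ => ContDiffAt.sum fun n _ =>
    (hW a b m n).mul (hN m n))

theorem contDiffAt_formProj {β : E8 → Matrix (Fin 8) (Fin 8) ℝ}
    (hG : ∀ a b, ContDiffAt ℝ ∞ (fun z => G z a b) y) (hu : IsUnit (G y).det)
    (hW : ∀ k l m n, ContDiffAt ℝ ∞ (fun z => W z k l m n) y)
    (hβ : ∀ a b, ContDiffAt ℝ ∞ (fun z => β z a b) y) (a b : Fin 8) :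
    ContDiffAt ℝ ∞ (fun z => formProj (G z) (W z) (β z) a b) y := by
  have h1 := contDiffAt_formOp hG hu hW hβ
  have h2 := contDiffAt_formOp hG hu hW h1
  simp only [formProj_apply, Matrix.sub_apply, Matrix.add_apply, Matrix.smul_apply, smul_eq_mul]
  exact ((contDiffAt_const.mul (hβ a b)).add (contDiffAt_const.mul (h1 a b))).sub
    (contDiffAt_const.mul (h2 a b))

theorem contDiffAt_gradVec (hf : ContDiffAt ℝ ∞ f y) (i : Fin 8) :
    ContDiffAt ℝ ∞ (fun z => gradVec f z i) y :=
  (hf.fderiv_right (m := ∞) (by simp)).clm_apply contDiffAt_const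

theorem contDiffAt_flatWedge (hG : ∀ a b, ContDiffAt ℝ ∞ (fun z => G z a b) y)
    (hf : ContDiffAt ℝ ∞ f y) (l a b : Fin 8) :
    ContDiffAt ℝ ∞ (fun z => flatWedge (G z) (gradVec f z) l a b) y := by
  simp only [flatWedge, Matrix.of_apply]
  exact ((hG l a).mul (contDiffAt_gradVec hf b)).sub ((contDiffAt_gradVec hf a).mul (hG l b))

theorem pderiv_gradVec_comm (hf : ContDiffAt ℝ ∞ f y) (i j : Fin 8) :
    pderiv i (fun z => gradVec f z j) y = pderiv j (fun z => gradVec f z i) y := by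
  have hd : DifferentiableAt ℝ (fderiv ℝ f) y :=
    (hf.fderiv_right (m := ∞) (by simp)).differentiableAt (by simp)
  have h (i j : Fin 8) : pderiv i (fun z => gradVec f z j) y =
      fderiv ℝ (fderiv ℝ f) y (stdVec i) (stdVec j) := by
    change fderiv ℝ (fun z => fderiv ℝ f z (stdVec j)) y (stdVec i) = _
    rw [fderiv_clm_apply hd (differentiableAt_const _)]
    simp
  rw [h, h]
  exact hf.isSymmSndFDerivAt (by simp; exact WithTop.coe_le_coe.2 le_top) (stdVec i) (stdVec j)

/-- The covariant derivative of the 2-forms `e_l♭ ∧ df` in terms of the Hessian of `f`. -/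
theorem nabla_flatWedge (hG : ∀ a b, ContDiffAt ℝ ∞ (fun z => G z a b) y)
    (hs : ∀ᶠ z in nhds y, (G z)ᵀ = G z) (hu : IsUnit (G y).det)
    (hf : ContDiffAt ℝ ∞ f y) (i l : Fin 8) :
    pderivMat i (fun z => flatWedge (G z) (gradVec f z) l) y -
        (connMat G y i * flatWedge (G y) (gradVec f y) l +
          flatWedge (G y) (gradVec f y) l * (connMat G y i)ᵀ) -
        ∑ p, christoffel G y p i l • flatWedge (G y) (gradVec f y) p =
      flatWedge (G y) (fun p => pderiv i (fun z => gradVec f z p) y -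
        ∑ q, christoffel G y q i p * gradVec f y q) l := by
  have hdG : EntryDiffAt G y := fun a b => (hG a b).differentiableAt (by simp)
  have hdf (k : Fin 8) : DifferentiableAt ℝ (fun z => gradVec f z k) y :=
    (contDiffAt_gradVec hf k).differentiableAt (by simp)
  have hm (k : Fin 8) : pderiv i (fun z => G z l k) y =
      ∑ q, christoffel G y q i l * G y q k + ∑ q, G y l q * christoffel G y q i k :=
    congrFun (congrFun (pderivMat_metric hs hu i) l) k
  ext k p
  have e1 : pderivMat i (fun z => flatWedge (G z) (gradVec f z) l) y k p =
      (pderiv i (fun z => G z l k) y * gradVec f y p +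
        G y l k * pderiv i (fun z => gradVec f z p) y) -
      (pderiv i (fun z => gradVec f z k) y * G y l p +
        gradVec f y k * pderiv i (fun z => G z l p) y) := by
    have d1 : DifferentiableAt ℝ (fun z => G z l k * gradVec f z p) y := (hdG l k).mul (hdf p)
    have d2 : DifferentiableAt ℝ (fun z => gradVec f z k * G z l p) y := (hdf k).mul (hdG l p)
    refine (pderiv_sub i d1 d2).trans ?_
    rw [pderiv_mul i (hdG l k) (hdf p), pderiv_mul i (hdf k) (hdG l p)]
  rw [Matrix.sub_apply, Matrix.sub_apply, e1, hm, hm]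
  simp only [Matrix.add_apply, Matrix.mul_apply, Matrix.sum_apply,
    Matrix.smul_apply, smul_eq_mul, flatWedge, connMat, Matrix.of_apply, Matrix.transpose_apply]
  simp only [mul_sub, sub_mul, add_mul, mul_add, Finset.mul_sum, Finset.sum_mul,
    Finset.sum_sub_distrib]
  have c1 : ∑ x, christoffel G y x i k * (G y l x * gradVec f y p) =
      ∑ x, G y l x * christoffel G y x i k * gradVec f y p :=
    Finset.sum_congr rfl fun _ _ => by ring
  have c2 : ∑ x, christoffel G y x i k * (gradVec f y x * G y l p) =
      ∑ x, christoffel G y x i k * gradVec f y x * G y l p :=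
    Finset.sum_congr rfl fun _ _ => by ring
  have c3 : ∑ x, G y l k * gradVec f y x * christoffel G y x i p =
      ∑ x, G y l k * (christoffel G y x i p * gradVec f y x) :=
    Finset.sum_congr rfl fun _ _ => by ring
  have c4 : ∑ x, gradVec f y k * G y l x * christoffel G y x i p =
      ∑ x, gradVec f y k * (G y l x * christoffel G y x i p) :=
    Finset.sum_congr rfl fun _ _ => by ring
  have c5 : ∑ x, christoffel G y x i l * (G y x k * gradVec f y p) =
      ∑ x, christoffel G y x i l * G y x k * gradVec f y p :=
    Finset.sum_congr rfl fun _ _ => by ring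
  have c6 : ∑ x, christoffel G y x i l * (gradVec f y k * G y x p) =
      ∑ x, gradVec f y k * (christoffel G y x i l * G y x p) :=
    Finset.sum_congr rfl fun _ _ => by ring
  rw [c1, c2, c3, c4, c5, c6]
  ring

/-- The divergence of the 2-forms `e_l♭ ∧ df` vanishes, by the symmetry of the Hessian. -/
theorem div_flatWedge (hG : ∀ a b, ContDiffAt ℝ ∞ (fun z => G z a b) y)
    (hs : ∀ᶠ z in nhds y, (G z)ᵀ = G z) (hu : IsUnit (G y).det)
    (hf : ContDiffAt ℝ ∞ f y) :
    ∑ i, ∑ l, (G y)⁻¹ i l •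
      (pderivMat i (fun z => flatWedge (G z) (gradVec f z) l) y -
        (connMat G y i * flatWedge (G y) (gradVec f y) l +
          flatWedge (G y) (gradVec f y) l * (connMat G y i)ᵀ) -
        ∑ p, christoffel G y p i l • flatWedge (G y) (gradVec f y) p) = 0 := by
  simp only [nabla_flatWedge hG hs hu hf]
  set S : Fin 8 → Fin 8 → ℝ := fun i p => pderiv i (fun z => gradVec f z p) y -
    ∑ q, christoffel G y q i p * gradVec f y q with hS
  have hsymm (i p : Fin 8) : S i p = S p i := by
    simp only [hS]
    rw [pderiv_gradVec_comm hf]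
    congr 1
    exact Finset.sum_congr rfl fun q _ => by rw [christoffel_symm hs]
  have h1 (i k : Fin 8) : ∑ l, (G y)⁻¹ i l * G y l k = if i = k then 1 else 0 := by
    have := congrFun (congrFun (Matrix.nonsing_inv_mul _ hu) i) k
    rw [Matrix.mul_apply, Matrix.one_apply] at this
    exact this
  ext k p
  have h2 (i : Fin 8) : ∑ l, (G y)⁻¹ i l * (G y l k * S i p - S i k * G y l p) =
      (if i = k then 1 else 0) * S i p - S i k * (if i = p then 1 else 0) := by
    rw [← h1, ← h1, Finset.sum_mul, Finset.mul_sum, ← Finset.sum_sub_distrib]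
    exact Finset.sum_congr rfl fun l _ => by ring
  simp only [Matrix.sum_apply, Matrix.smul_apply, smul_eq_mul, flatWedge, Matrix.of_apply,
    Matrix.zero_apply]
  refine (Finset.sum_congr rfl fun i _ => h2 i).trans ?_
  simp [Finset.sum_sub_distrib, hsymm k p]

/-- The intrinsic torsion of a structure that the function `f` rescales to a parallel one. -/
def confTorsion (G : E8 → Matrix (Fin 8) (Fin 8) ℝ)
    (W : E8 → Fin 8 → Fin 8 → Fin 8 → Fin 8 → ℝ) (f : E8 → ℝ) (z : E8) (l j k : Fin 8) : ℝ :=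
  formProj (G z) (W z) (flatWedge (G z) (gradVec f z) l) j k

theorem contDiffAt_confTorsion (hG : ∀ a b, ContDiffAt ℝ ∞ (fun z => G z a b) y)
    (hu : IsUnit (G y).det) (hW : ∀ k l m n, ContDiffAt ℝ ∞ (fun z => W z k l m n) y)
    (hf : ContDiffAt ℝ ∞ f y) (l j k : Fin 8) :
    ContDiffAt ℝ ∞ (fun z => confTorsion G W f z l j k) y :=
  contDiffAt_formProj hG hu hW (contDiffAt_flatWedge hG hf l) j k

/-- The covariant derivative of the form is its `diamond` with e_i♭ ∧ df, and `diamond_quatProj`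
allows that 2-form to be projected to Λ²₁₅. -/
theorem isIntrinsicTorsionAt_confTorsion (hG : ∀ a b, ContDiffAt ℝ ∞ (fun z => G z a b) y)
    (hW : ∀ k l m n, ContDiffAt ℝ ∞ (fun z => W z k l m n) y) (hf : ContDiffAt ℝ ∞ f y)
    {u v w : Matrix (Fin 8) (Fin 8) ℝ} (hq : IsQuaternionic (G y) (W y) u v w)
    (h : ∀ i k l m n, nablaForm (fun z => Real.exp (-2 * f z) • G z)
      (fun z k l m n => Real.exp (-4 * f z) * W z k l m n) y i k l m n = 0) :
    IsIntrinsicTorsionAt G W y (confTorsion G W f y) := by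
  intro i
  have ht := flatWedge_transpose (G y) (gradVec f y) i
  have e : confTorsion G W f y i = fun j k => (quatProj (u * (G y)⁻¹) (v * (G y)⁻¹)
      (w * (G y)⁻¹) (flatWedge (G y) (gradVec f y) i * (G y)⁻¹) * G y) j k := by
    funext j k
    rw [confTorsion, hq.formProj_eq ht]
  rw [e]
  refine ⟨hq.isLambda15 ht, fun k l m n => ?_⟩
  rw [hq.diamond_quatProj ht, diamond_matrix, nablaForm_eq, pderiv_form_of_nablaForm_eq_zero
    (fun a b => (hG a b).differentiableAt (by simp)) hq.symm hq.isUnit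
    (hf.differentiableAt (by simp)) (fun k l m n => (hW k l m n).differentiableAt (by simp)) i
    (h i), actForm_add]
  ring

theorem divTorsion_confTorsion (hG : ∀ a b, ContDiffAt ℝ ∞ (fun z => G z a b) y)
    (hW : ∀ k l m n, ContDiffAt ℝ ∞ (fun z => W z k l m n) y) (hf : ContDiffAt ℝ ∞ f y)
    {u v w : Matrix (Fin 8) (Fin 8) ℝ} (hq : IsQuaternionic (G y) (W y) u v w)
    (hs : ∀ᶠ z in nhds y, (G z)ᵀ = G z) (hu : ∀ᶠ z in nhds y, IsUnit (G z).det)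
    (h : ∀ i k l m n, nablaForm (fun z => Real.exp (-2 * f z) • G z)
      (fun z k l m n => Real.exp (-4 * f z) * W z k l m n) y i k l m n = 0) (j k : Fin 8) :
    divTorsion G (confTorsion G W f) y j k = 0 := by
  set P := formProj (G y) (W y) with hP
  set α : Fin 8 → Matrix (Fin 8) (Fin 8) ℝ := fun l => flatWedge (G y) (gradVec f y) l with hα
  set A := connMat G y with hA
  have hαt (l : Fin 8) : (α l)ᵀ = -α l := flatWedge_transpose _ _ _
  have hGd : EntryDiffAt G y := fun a b => (hG a b).differentiableAt (by simp)
  have hWd (k l m n : Fin 8) : DifferentiableAt ℝ (fun z => W z k l m n) y :=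
    (hW k l m n).differentiableAt (by simp)
  -- Adding the skew part `α i` keeps the connection metric.
  have hGA (i : Fin 8) : pderivMat i G y =
      (A i + α i * (G y)⁻¹) * G y + G y * (A i + α i * (G y)⁻¹)ᵀ := by
    have e1 : α i * (G y)⁻¹ * G y = α i := by
      rw [mul_assoc, Matrix.nonsing_inv_mul _ hq.isUnit, mul_one]
    have e2 : G y * (α i * (G y)⁻¹)ᵀ = -α i := by
      rw [Matrix.transpose_mul, hq.inv_symm, hαt, ← mul_assoc,
        Matrix.mul_nonsing_inv _ hq.isUnit, one_mul]
    rw [pderivMat_metric hs hq.isUnit, add_mul, Matrix.transpose_add, mul_add, e1, e2]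
    abel
  have hWA (i k l m n : Fin 8) : pderiv i (fun z => W z k l m n) y =
      actForm (A i + α i * (G y)⁻¹) (W y) k l m n :=
    pderiv_form_of_nablaForm_eq_zero hGd hq.symm hq.isUnit (hf.differentiableAt (by simp)) hWd i
      (h i) k l m n
  have hpar (i l : Fin 8) := pderivMat_formProj i hG hu hWd (hGA i) (hWA i)
    (β := fun z => flatWedge (G z) (gradVec f z) l)
    (fun a b => (contDiffAt_flatWedge hG hf l a b).differentiableAt (by simp))
  -- Conversion of the parallelism of the projection from D = ∇ - α back to ∇; each side acquires an
  -- action of `α i`.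
  have hnab (i l : Fin 8) :
      (pderivMat i (fun z => formProj (G z) (W z) (flatWedge (G z) (gradVec f z) l)) y -
        (A i * P (α l) + P (α l) * (A i)ᵀ)) - ∑ p, christoffel G y p i l • P (α p) =
      P (pderivMat i (fun z => flatWedge (G z) (gradVec f z) l) y -
        (A i * α l + α l * (A i)ᵀ) - ∑ p, christoffel G y p i l • α p) -
      P (α i * (G y)⁻¹ * α l + α l * (α i * (G y)⁻¹)ᵀ) +
      (α i * (G y)⁻¹ * P (α l) + P (α l) * (α i * (G y)⁻¹)ᵀ) := by
    have e1 : pderivMat i (fun z => formProj (G z) (W z) (flatWedge (G z) (gradVec f z) l)) y -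
        ((A i + α i * (G y)⁻¹) * P (α l) + P (α l) * (A i + α i * (G y)⁻¹)ᵀ) =
      P (pderivMat i (fun z => flatWedge (G z) (gradVec f z) l) y -
        ((A i + α i * (G y)⁻¹) * α l + α l * (A i + α i * (G y)⁻¹)ᵀ)) := hpar i l
    rw [sub_eq_iff_eq_add] at e1
    rw [e1]
    simp only [add_mul, Matrix.transpose_add, mul_add, map_sub, map_add, map_sum, map_smul]
    abel
  have hcomm (X : Fin 8 → Matrix (Fin 8) (Fin 8) ℝ) (i l : Fin 8) :
      α i * (G y)⁻¹ * X l + X l * (α i * (G y)⁻¹)ᵀ =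
        (α i * (G y)⁻¹ * (X l * (G y)⁻¹) - X l * (G y)⁻¹ * (α i * (G y)⁻¹)) * G y :=
    deriv_eq_commutator hq (hαt i)
  have hsum : ∑ i, ∑ l, (G y)⁻¹ i l •
      ((pderivMat i (fun z => formProj (G z) (W z) (flatWedge (G z) (gradVec f z) l)) y -
        (A i * P (α l) + P (α l) * (A i)ᵀ)) - ∑ p, christoffel G y p i l • P (α p)) = 0 := by
    -- At the point `y` the projection is a fixed linear map, so it comes out of the trace.
    have s1 : ∑ i, ∑ l, (G y)⁻¹ i l • P (pderivMat i
        (fun z => flatWedge (G z) (gradVec f z) l) y -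
        (A i * α l + α l * (A i)ᵀ) - ∑ p, christoffel G y p i l • α p) = 0 := by
      simp only [← map_smul, ← map_sum]
      rw [div_flatWedge hG hs hq.isUnit hf, map_zero]
    -- The bracket of `α i` and `α l` is skew in the two indices, the inverse metric symmetric.
    have s2 : ∑ i, ∑ l, (G y)⁻¹ i l •
        P (α i * (G y)⁻¹ * α l + α l * (α i * (G y)⁻¹)ᵀ) = 0 := by
      simp only [← map_smul, ← map_sum, hcomm α, ← Matrix.smul_mul, ← Finset.sum_mul]
      simp only [smul_sub, Finset.sum_sub_distrib]
      rw [sum_comm_flatWedge hq.symm, sub_self, zero_mul, map_zero]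
    have s3 : ∑ i, ∑ l, (G y)⁻¹ i l •
        (α i * (G y)⁻¹ * P (α l) + P (α l) * (α i * (G y)⁻¹)ᵀ) = 0 := by
      have e (l : Fin 8) : P (α l) * (G y)⁻¹ =
          quatProj (u * (G y)⁻¹) (v * (G y)⁻¹) (w * (G y)⁻¹) (α l * (G y)⁻¹) := by
        rw [hP, hq.formProj_eq (hαt l), mul_assoc, Matrix.mul_nonsing_inv _ hq.isUnit, mul_one]
      simp only [hcomm fun l => P (α l), ← Matrix.smul_mul, ← Finset.sum_mul, e]
      rw [hq.sum_commutator, zero_mul]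
    have e (i l : Fin 8) := congrArg ((G y)⁻¹ i l • ·) (hnab i l)
    simp only [smul_add (_ : ℝ) (_ - _) _, smul_sub (_ : ℝ) (P _) (P _)] at e
    simp only [e, Finset.sum_add_distrib, Finset.sum_sub_distrib, s1, s2, s3]
    simp
  have := congrFun (congrFun hsum j) k
  rw [Matrix.zero_apply] at this
  rw [← this, divTorsion]
  simp only [Matrix.sum_apply]
  refine Finset.sum_congr rfl fun i _ => Finset.sum_congr rfl fun l _ => ?_
  rw [Matrix.smul_apply, smul_eq_mul]
  congr 1
  have e0 : pderivMat i (fun z => formProj (G z) (W z) (flatWedge (G z) (gradVec f z) l)) y j k =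
      pderiv i (fun z => confTorsion G W f z l j k) y := rfl
  have e1 : (P (α l) * (A i)ᵀ) j k =
      ∑ p, christoffel G y p i k * confTorsion G W f y l j p := by
    rw [Matrix.mul_apply]
    exact Finset.sum_congr rfl fun p _ => mul_comm _ _
  have e2 : (A i * P (α l)) j k = ∑ p, christoffel G y p i j * confTorsion G W f y l p k := rfl
  have e3 : (∑ p, christoffel G y p i l • P (α p)) j k =
      ∑ p, christoffel G y p i l * confTorsion G W f y p j k := by
    rw [Matrix.sum_apply]; rfl
  rw [Matrix.sub_apply, Matrix.sub_apply, Matrix.add_apply, e0, e1, e2, e3, nablaTorsion]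
  simp only [Finset.sum_add_distrib]
  ring

end

/-! ### Passage to charts -/

section Charts

variable {M : Type*} [TopologicalSpace M] [ChartedSpace E8 M]
  {e : OpenPartialHomeomorph M E8}

theorem coordMetric_smul
    (g : (x : M) → TangentSpace 𝓘(ℝ, E8) x →L[ℝ] TangentSpace 𝓘(ℝ, E8) x →L[ℝ] ℝ) (c : M → ℝ) :
    coordMetric (fun p => c p • g p) e = fun y => c (e.symm y) • coordMetric g e y := rfl

theorem coordForm_smul (Ω : (x : M) → TangentSpace 𝓘(ℝ, E8) x [⋀^Fin 4]→L[ℝ] ℝ) (c : M → ℝ) :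
    coordForm (fun p => c p • Ω p) e = fun y i j k l => c (e.symm y) * coordForm Ω e y i j k l :=
  rfl

theorem linearIndependent_coordVec (he : e ∈ IsManifold.maximalAtlas 𝓘(ℝ, E8) ∞ M) {y : E8}
    (hy : y ∈ e.target) : LinearIndependent ℝ (coordVec e y) := by
  have hd : e.MDifferentiable 𝓘(ℝ, E8) 𝓘(ℝ, E8) :=
    ⟨(contMDiffOn_of_mem_maximalAtlas he).mdifferentiableOn (by simp),
      (contMDiffOn_symm_of_mem_maximalAtlas he).mdifferentiableOn (by simp)⟩
  have hinj : Function.Injective (mfderiv 𝓘(ℝ, E8) 𝓘(ℝ, E8) e.symm y) :=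
    hd.symm.mfderiv_injective hy
  have hstd : LinearIndependent ℝ stdVec := by
    have h : stdVec = (EuclideanSpace.basisFun (Fin 8) ℝ).toBasis := by
      funext i
      simp [stdVec]
    rw [h]
    exact (EuclideanSpace.basisFun (Fin 8) ℝ).toBasis.linearIndependent
  exact hstd.map' (mfderiv 𝓘(ℝ, E8) 𝓘(ℝ, E8) e.symm y).toLinearMap
    (LinearMap.ker_eq_bot.2 hinj)

variable [IsManifold 𝓘(ℝ, E8) ∞ M]

/-- The coordinate field is the tangent map of the inverse chart applied to a constant field. -/
theorem contMDiffOn_coordVec (he : e ∈ IsManifold.maximalAtlas 𝓘(ℝ, E8) ∞ M) (i : Fin 8) :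
    ContMDiffOn 𝓘(ℝ, E8) (𝓘(ℝ, E8).prod 𝓘(ℝ, E8)) ∞
      (fun y => Bundle.TotalSpace.mk' E8 (E := fun x : M => TangentSpace 𝓘(ℝ, E8) x)
        (e.symm y) (coordVec e y i)) e.target := by
  have h1 := (contMDiffOn_symm_of_mem_maximalAtlas he).contMDiffOn_tangentMapWithin
    (m := ∞) (by simp) e.open_target.uniqueMDiffOn
  have h2 : ContMDiffOn 𝓘(ℝ, E8) (𝓘(ℝ, E8).prod 𝓘(ℝ, E8)) ∞
      (fun y : E8 => (⟨y, stdVec i⟩ : TangentBundle 𝓘(ℝ, E8) E8)) e.target :=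
    contMDiffOn_vectorSpace_iff_contDiffOn.2 contDiffOn_const
  refine (h1.comp h2 fun y hy => hy).congr fun y hy => ?_
  simp only [Function.comp, tangentMapWithin, coordVec]
  rw [mfderivWithin_of_isOpen e.open_target hy]

theorem contDiffOn_coordMetric
    (g : Bundle.ContMDiffRiemannianMetric 𝓘(ℝ, E8) ∞ E8 (fun x : M => TangentSpace 𝓘(ℝ, E8) x))
    (he : e ∈ IsManifold.maximalAtlas 𝓘(ℝ, E8) ∞ M) (i j : Fin 8) :
    ContDiffOn ℝ ∞ (fun y => coordMetric g.inner e y i j) e.target := by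
  rw [← contMDiffOn_iff_contDiffOn]
  intro y hy
  have h : ContMDiffWithinAt 𝓘(ℝ, E8) (𝓘(ℝ, E8).prod 𝓘(ℝ)) ∞
      (fun m => Bundle.TotalSpace.mk' ℝ (E := Bundle.Trivial M ℝ) (e.symm m)
        (g.inner (e.symm m) (coordVec e m i) (coordVec e m j))) e.target y := by
    apply ContMDiffWithinAt.clm_bundle_apply₂ (F₁ := E8) (F₂ := E8)
    · exact ContMDiffAt.comp_contMDiffWithinAt y g.contMDiff.contMDiffAt
        (contMDiffOn_symm_of_mem_maximalAtlas he y hy)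
    · exact contMDiffOn_coordVec he i y hy
    · exact contMDiffOn_coordVec he j y hy
  simp only [Bundle.contMDiffWithinAt_totalSpace] at h
  exact h.2

theorem Sp2Sp1Structure.exists_quaternionic (S : Sp2Sp1Structure M)
    (he : e ∈ IsManifold.maximalAtlas 𝓘(ℝ, E8) ∞ M) {y : E8} (hy : y ∈ e.target) :
    ∃ R u v w : Matrix (Fin 8) (Fin 8) ℝ, IsUnit R.det ∧
      coordMetric S.metric.inner e y = R * Rᵀ ∧
      IsQuaternionic (coordMetric S.metric.inner e y) (coordForm S.form e y) u v w :=
  (S.adapted (e.symm y)).exists_quaternionic (linearIndependent_coordVec he hy)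

/-- The local form of the intrinsic torsion of a locally conformally parallel structure. -/
theorem Sp2Sp1Structure.IsLocallyConformallyParallel.exists_torsion {S : Sp2Sp1Structure M}
    (hS : S.IsLocallyConformallyParallel) (he : e ∈ IsManifold.maximalAtlas 𝓘(ℝ, E8) ∞ M)
    {y : E8} (hy : y ∈ e.target) :
    ∃ T : E8 → Fin 8 → Fin 8 → Fin 8 → ℝ,
      (∀ i j k, ContDiffAt ℝ ∞ (fun z => T z i j k) y) ∧
      (∀ᶠ z in nhds y, IsIntrinsicTorsionAt (coordMetric S.metric.inner e)
        (coordForm S.form e) z (T z)) ∧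
      ∀ j k, divTorsion (coordMetric S.metric.inner e) T y j k = 0 := by
  obtain ⟨U, hU, hyU, f, hf, hT⟩ := hS (e.symm y)
  set G := coordMetric S.metric.inner e with hGdef
  set W := coordForm S.form e with hWdef
  set φ : E8 → ℝ := fun z => f (e.symm z) with hφ
  set V : Set E8 := e.target ∩ e.symm ⁻¹' U with hV
  have hVo : IsOpen V := e.symm.isOpen_inter_preimage hU
  have hyV : y ∈ V := ⟨hy, hyU⟩
  have hG {z : E8} (hz : z ∈ V) (a b : Fin 8) : ContDiffAt ℝ ∞ (fun z => G z a b) z :=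
    (contDiffOn_coordMetric S.metric he a b).contDiffAt (e.open_target.mem_nhds hz.1)
  have hW {z : E8} (hz : z ∈ V) (k l m n : Fin 8) :
      ContDiffAt ℝ ∞ (fun z => W z k l m n) z :=
    (S.smooth_form e he k l m n).contDiffAt (e.open_target.mem_nhds hz.1)
  have hφs : ContDiffOn ℝ ∞ φ V := by
    rw [← contMDiffOn_iff_contDiffOn]
    exact hf.comp ((contMDiffOn_symm_of_mem_maximalAtlas he).mono Set.inter_subset_left)
      fun z hz => hz.2
  have hφa {z : E8} (hz : z ∈ V) : ContDiffAt ℝ ∞ φ z := hφs.contDiffAt (hVo.mem_nhds hz)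
  have hn {z : E8} (hz : z ∈ V) (i k l m n : Fin 8) :
      nablaForm (fun z => Real.exp (-2 * φ z) • G z)
        (fun z k l m n => Real.exp (-4 * φ z) * W z k l m n) z i k l m n = 0 := by
    have h1 := (hT e he z hz.1 hz.2 i).2 k l m n
    rw [coordMetric_smul, coordForm_smul] at h1
    rw [h1]
    simp [diamond]
  have hq {z : E8} (hz : z ∈ V) := S.exists_quaternionic he hz.1
  have hVn {z : E8} (hz : z ∈ V) : ∀ᶠ x in nhds z, x ∈ V := hVo.mem_nhds hz
  have hs {z : E8} (hz : z ∈ V) : ∀ᶠ x in nhds z, (G x)ᵀ = G x := by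
    filter_upwards [hVn hz] with x hx
    obtain ⟨_, _, _, _, _, _, h⟩ := hq hx
    exact h.symm
  have hu {z : E8} (hz : z ∈ V) : ∀ᶠ x in nhds z, IsUnit (G x).det := by
    filter_upwards [hVn hz] with x hx
    obtain ⟨_, _, _, _, _, _, h⟩ := hq hx
    exact h.isUnit
  refine ⟨confTorsion G W φ, ?_, ?_, ?_⟩
  · exact contDiffAt_confTorsion (hG hyV) (hu hyV).self_of_nhds (hW hyV) (hφa hyV)
  -- The torsion property is needed on a neighbourhood and not just at `y`: the divergence and the
  -- later comparison involve germs.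
  · filter_upwards [hVn hyV] with z hz
    obtain ⟨_, _, _, _, _, _, h⟩ := hq hz
    exact isIntrinsicTorsionAt_confTorsion (hG hz) (hW hz) (hφa hz) h (hn hz)
  · obtain ⟨_, _, _, _, _, _, h⟩ := hq hyV
    exact divTorsion_confTorsion (hG hyV) (hW hyV) (hφa hyV) h (hs hyV) (hu hyV) (hn hyV)

end Charts

/-! ### Gluing the local torsions -/

theorem divTorsion_congr {G : E8 → Matrix (Fin 8) (Fin 8) ℝ}
    {T T' : E8 → Fin 8 → Fin 8 → Fin 8 → ℝ} {y : E8} (h : T =ᶠ[nhds y] T') (j k : Fin 8) :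
    divTorsion G T y j k = divTorsion G T' y j k := by
  have h1 (i l j k : Fin 8) :
      pderiv i (fun z => T z l j k) y = pderiv i (fun z => T' z l j k) y :=
    pderiv_congr (h.mono fun z hz => by rw [hz]) i
  simp only [divTorsion, nablaTorsion, h1, h.self_of_nhds]

end QK

end

theorem mainTheorem1 {M : Type*} [TopologicalSpace M] [ChartedSpace QK.E8 M]
    [IsManifold 𝓘(ℝ, QK.E8) ∞ M] (S : QK.Sp2Sp1Structure M)
    (hS : S.IsLocallyConformallyParallel) : S.IsHarmonic := by
  intro e he
  -- The torsion is chosen point by point, with the irrelevant value 0 off the chart target;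
  -- smoothness comes afterwards from uniqueness.
  have hex (y : QK.E8) : ∃ t : Fin 8 → Fin 8 → Fin 8 → ℝ, y ∈ e.target →
      QK.IsIntrinsicTorsionAt (QK.coordMetric S.metric.inner e) (QK.coordForm S.form e) y t := by
    by_cases hy : y ∈ e.target
    · obtain ⟨T, _, hT, _⟩ := hS.exists_torsion he hy
      exact ⟨T y, fun _ => hT.self_of_nhds⟩
    · exact ⟨0, fun h => absurd h hy⟩
  choose T hT using hex
  have key (y : QK.E8) (hy : y ∈ e.target) : ∃ T' : QK.E8 → Fin 8 → Fin 8 → Fin 8 → ℝ,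
      T =ᶠ[nhds y] T' ∧ (∀ i j k, ContDiffAt ℝ ∞ (fun z => T' z i j k) y) ∧
      ∀ j k, QK.divTorsion (QK.coordMetric S.metric.inner e) T' y j k = 0 := by
    obtain ⟨T', h1, h2, h3⟩ := hS.exists_torsion he hy
    refine ⟨T', ?_, h1, h3⟩
    -- Near `y` both functions are intrinsic torsions, so they have the same germ whatever local
    -- function `f` was used.
    filter_upwards [h2, e.open_target.mem_nhds hy] with z hz hze
    obtain ⟨R, _, _, _, hR, hG, _⟩ := S.exists_quaternionic he hze
    exact (hT z hze).unique hR hG hz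
  refine ⟨T, fun i j k y hy => ?_, fun y hy => ⟨hT y hy, fun j k => ?_⟩⟩
  · obtain ⟨T', h1, h2, _⟩ := key y hy
    refine ((h2 i j k).congr_of_eventuallyEq ?_).contDiffWithinAt
    exact h1.mono fun z hz => by simp only [hz]
  · obtain ⟨T', h1, _, h3⟩ := key y hy
    rw [QK.divTorsion_congr h1, h3]
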